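/- For $m,n\ge 0$ let $K_{m,n}$ be the complete bipartite graph with vertex set $V=\{1,\dots,m\}\sqcup\{1,\dots,n\}$; it is connected exactly when $m,n\ge 1$ or $\{m,n\}=\{0,1\}$. Its graphical building set $B(K_{m,n})$ consists of all nonempty $S\subseteq V$ whose induced subgraph is connected, and its nestohedron is the Minkowski sum $$P_{K_{m,n}}=\sum_{S\in B(K_{m,n})}\Delta_S\subset\mathbb R^V,\qquad \Delta_S=\operatorname{conv}\{e_i : i\in S\}.$$ For an $N$-dimensional polytope $P$ with $f_i$ faces of dimension $i$ (so $f_N=1$), put $$f(P)(\alpha,t)=\sum_{i=0}^{N} f_i\,\alpha^{i}t^{N-i},\qquad h(P)(\alpha,t)=f(P)(\alpha-t,t).$$ The $\gamma$-polynomial of $P$, if it exists, is the (unique) polynomial $\gamma(P)(\tau)=\sum_{0\le i\le N/2}\gamma_i\tau^i$ with $h(P)(\alpha,t)=\sum_{0\le i\le N/2}\gamma_i(\alpha t)^i(\alpha+t)^{N-2i}$. A series $\psi\in\mathbb Q[\alpha,t][[x,y]]$ is called a Gal series if 1. $\psi(\alpha,t,x,y)=\psi(t,\alpha,x,y)$;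 2. $\psi$ is homogeneous for the grading $\deg\alpha=\deg t=-2$, $\deg x=\deg y=2$; 3. $\psi(\alpha,t,x,y)=\hat\psi(\alpha+t,\alpha t,x,y)$ for a series $\hat\psi(a,b,x,y)\in\mathbb Q[a,b][[x,y]]$ all of whose coefficients are non-negative. **Theorem.** The series $$\sum_{\substack{k,l\ge 0\\ K_{k,l}\text{ connected}}} h(P_{K_{k,l}})(\alpha,t)\,\frac{x^k}{k!}\,\frac{y^l}{l!}\;\in\;\mathbb Q[\alpha,t][[x,y]]$$ is a Gal series. Moreover, for all $m,n\ge 0$ for which $K_{m,n}$ is connected, the $\gamma$-polynomial of $P_{K_{m,n}}$ exists and has non-negative coefficients, that is, the conclusion of Gal's conjecture holds for these nestohedra. -/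

import Mathlib

noncomputable section

open scoped Pointwise

/-- The dimension of a set in a real vector space: the dimension of its affine hull. -/
def polytopeDim {E : Type*} [AddCommGroup E] [Module ℝ E] (P : Set E) : ℕ :=
  Module.finrank ℝ (vectorSpan ℝ P)

/-- The number `f_i` of nonempty `i`-dimensional faces of `P`. A face is the set of points of `P`
where some linear functional attains its maximum over `P`; the zero functional gives `P` itself. -/
def faceCount {E : Type*} [NormedAddCommGroup E] [NormedSpace ℝ E] (P : Set E) (i : ℕ) : ℕ :=
  {F : Set E | IsExposed ℝ P F ∧ F.Nonempty ∧ polytopeDim F = i}.ncard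

/-- The homogeneous `f`-polynomial `f(P)(α,t) = ∑ i, f_i α ^ i t ^ (n - i)` of an `n`-dimensional
polytope, `α` being `X 0` and `t` being `X 1`. -/
def fPolynomial {E : Type*} [NormedAddCommGroup E] [NormedSpace ℝ E] (P : Set E) :
    MvPolynomial (Fin 2) ℚ :=
  ∑ i ∈ Finset.range (polytopeDim P + 1),
    MvPolynomial.C (faceCount P i : ℚ) * MvPolynomial.X 0 ^ i *
      MvPolynomial.X 1 ^ (polytopeDim P - i)

/-- The `h`-polynomial `h(P)(α,t) = f(P)(α - t,t)`. -/
def hPolynomial {E : Type*} [NormedAddCommGroup E] [NormedSpace ℝ E] (P : Set E) :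
    MvPolynomial (Fin 2) ℚ :=
  MvPolynomial.aeval ![(MvPolynomial.X 0 - MvPolynomial.X 1 : MvPolynomial (Fin 2) ℚ),
    MvPolynomial.X 1] (fPolynomial P)

/-- `γ = ∑ i, γ_i τ ^ i` is the `γ`-polynomial of the `n`-dimensional polytope `P`:
`2 * deg γ ≤ n` and `h(P)(α,t) = ∑ i, γ_i (α t) ^ i (α + t) ^ (n - 2 i)`. These conditions
determine `γ`. -/
def IsGammaPolynomial {E : Type*} [NormedAddCommGroup E] [NormedSpace ℝ E] (P : Set E)
    (γ : Polynomial ℚ) : Prop :=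
  2 * γ.natDegree ≤ polytopeDim P ∧
    hPolynomial P = ∑ i ∈ Finset.range (polytopeDim P / 2 + 1),
      MvPolynomial.C (γ.coeff i) * (MvPolynomial.X 0 * MvPolynomial.X 1) ^ i *
        (MvPolynomial.X 0 + MvPolynomial.X 1) ^ (polytopeDim P - 2 * i)

open Classical in
/-- The graphical building set of `Γ`: all nonempty sets of vertices that induce a connected
subgraph (`SimpleGraph.Connected` includes nonemptiness). -/
def graphicalBuildingSet {V : Type*} [Fintype V] (Γ : SimpleGraph V) : Finset (Finset V) :=
  Finset.univ.filter fun S => (Γ.induce (S : Set V)).Connected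

open Classical in
/-- The simplex `Δ_S`, the convex hull of the standard basis vectors `e_i` with `i ∈ S`. -/
def coordinateSimplex {V : Type*} (S : Finset V) : Set (V → ℝ) :=
  convexHull ℝ ((fun i : V => (Pi.single i 1 : V → ℝ)) '' (S : Set V))

/-- The nestohedron of a building set `B`: the Minkowski sum of the simplices `Δ_S`, `S ∈ B`. -/
def nestohedron {V : Type*} (B : Finset (Finset V)) : Set (V → ℝ) :=
  ∑ S ∈ B, coordinateSimplex S

/-- The nestohedron of the complete bipartite graph `K_{m,n}`. -/
def bipartiteNestohedron (m n : ℕ) : Set (Fin m ⊕ Fin n → ℝ) :=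
  nestohedron (graphicalBuildingSet (completeBipartiteGraph (Fin m) (Fin n)))

open Classical in
/-- The series `∑ h(P_{K_{k,l}})(α,t) x ^ k / k! y ^ l / l!` in `ℚ[α,t][[x,y]]`, the sum being over
the `k, l ≥ 0` for which `K_{k,l}` is connected; `x` and `y` are the variables `0` and `1`. -/
def bipartiteHSeries : MvPowerSeries (Fin 2) (MvPolynomial (Fin 2) ℚ) := fun d =>
  if (completeBipartiteGraph (Fin (d 0)) (Fin (d 1))).Connected then
    MvPolynomial.C (1 / ((d 0).factorial * (d 1).factorial : ℚ)) *
      hPolynomial (bipartiteNestohedron (d 0) (d 1))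
  else 0

/-- Gal series in `ℚ[α,t][[x_s : s ∈ σ]]`, with `α = X 0` and `t = X 1`:
the series is symmetric in `α` and `t`; it is homogeneous when `α` and `t` have degree `-2` and
every `x_s` has degree `2`; and it arises from a series with non-negative coefficients in
`a`, `b` (`X 0`, `X 1`) and the `x_s` by substituting `a = α + t`, `b = α t`. -/
structure IsGalSeries {σ : Type*} (ψ : MvPowerSeries σ (MvPolynomial (Fin 2) ℚ)) : Prop where
  symm : MvPowerSeries.map
    (MvPolynomial.rename (R := ℚ) (Equiv.swap (0 : Fin 2) 1)).toRingHom ψ = ψ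
  homogeneous : ∃ k : ℤ, ∀ (d : σ →₀ ℕ) (e : Fin 2 →₀ ℕ),
    MvPolynomial.coeff e (MvPowerSeries.coeff d ψ) ≠ 0 →
      2 * (d.degree : ℤ) - 2 * (e.degree : ℤ) = k
  nonneg : ∃ ψ' : MvPowerSeries σ (MvPolynomial (Fin 2) ℚ),
    ψ = MvPowerSeries.map
      (MvPolynomial.aeval (R := ℚ) ![(MvPolynomial.X 0 + MvPolynomial.X 1 :
        MvPolynomial (Fin 2) ℚ), MvPolynomial.X 0 * MvPolynomial.X 1]).toRingHom ψ' ∧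
    ∀ (d : σ →₀ ℕ) (e : Fin 2 →₀ ℕ),
      0 ≤ MvPolynomial.coeff e (MvPowerSeries.coeff d ψ')

end

/-!
The exposed faces of a Minkowski sum of simplices `Δ_S` are the sums of the faces on which a weight
`w` is largest, and such a face remembers which face of every summand it uses
(`toExposed_subset_of_sum_eq`). So the faces of a nestohedron correspond to the patterns
`S ↦ argmax_S w` for `S` in the building set, and a pattern on `U` consists of its top level set
`M ⊆ U` and an arbitrary pattern on `U \ M`; dimensions add up to `#M - 1 + dim`. This gives the
recursion `faceEnumerator_eq_sum`. For `K_{m,n}` the set `U \ M` either meets both sides, and is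
connected, or lies in one side, where all connected sets are single vertices, so the recursion only
involves the sizes of the two sides (`faceEnumerator_bipartite`).

Substituting `α - t` for the first variable turns the recursion into a closed formula for the
exponential generating series. Let `E` be the Eulerian series, the solution of
`E' = 1 + (α + t) E + α t E²` with `E(0) = 0`, and let `T` be the solution of
`T' = α t E + ((α + t) + α t E) T` with `T(0) = 0`. The terms with `k, l ≥ 1` sum to the series `H`
with
`H (1 - α t E(x) E(y)) = T(x) E(y) + E(x) T(y) + (α + t) E(x) E(y)`.
This is checked by clearing denominators: with `D = α e^{t x} - t e^{α x}` one has
`E D = e^{α x} - e^{t x}` and `(T + 1 + (α + t) E) D = (α - t) e^{(α + t) x}`, and then the equation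
for `H` becomes a polynomial identity in exponentials (`mul_sub_eq_of_mul_one_sub_eq`).

The two differential equations and the geometric series only involve `α + t` and `α t`, with
non-negative coefficients, so `H` is a non-negative series in these, which is the main part of being
a Gal series. Since every `h`-polynomial is homogeneous, taking its part of the right degree yields
the `γ`-polynomial (`homogeneousComponent_elementarySubst`).
-/

noncomputable section

open scoped Pointwise

/-! ### Faces and directions of Minkowski sums -/

/-- Maximizing a functional over a Minkowski sum means maximizing it over each summand. -/
theorem toExposed_add {E : Type*} [NormedAddCommGroup E] [NormedSpace ℝ E]
    (l : StrongDual ℝ E) (A B : Set E) :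
    l.toExposed (A + B) = l.toExposed A + l.toExposed B := by
  ext x
  constructor
  · rintro ⟨⟨a, ha, b, hb, rfl⟩, hmax⟩
    refine ⟨a, ⟨ha, fun y hy => ?_⟩, b, ⟨hb, fun y hy => ?_⟩, rfl⟩
    · have := hmax (y + b) (Set.add_mem_add hy hb)
      simpa using this
    · have := hmax (a + y) (Set.add_mem_add ha hy)
      simpa using this
  · rintro ⟨a, ha, b, hb, rfl⟩
    refine ⟨Set.add_mem_add ha.1 hb.1, ?_⟩
    rintro _ ⟨c, hc, d, hd, rfl⟩
    simpa using add_le_add (ha.2 c hc) (hb.2 d hd)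

theorem toExposed_sum {E ι : Type*} [NormedAddCommGroup E] [NormedSpace ℝ E]
    (l : StrongDual ℝ E) (A : ι → Set E) (s : Finset ι) :
    l.toExposed (∑ i ∈ s, A i) = ∑ i ∈ s, l.toExposed (A i) := by
  classical
  induction s using Finset.induction_on with
  | empty =>
    ext x
    simp only [Finset.sum_empty, ContinuousLinearMap.toExposed, Set.mem_ofPred_eq, Set.mem_zero]
    constructor
    · exact fun h => h.1
    · rintro rfl
      simp
  | insert i s hi ih => rw [Finset.sum_insert hi, toExposed_add, ih, Finset.sum_insert hi]

theorem nonempty_finsetSum {E ι : Type*} [AddCommMonoid E] (A : ι → Set E) (s : Finset ι)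
    (h : ∀ i ∈ s, (A i).Nonempty) : (∑ i ∈ s, A i).Nonempty := by
  classical
  induction s using Finset.induction_on with
  | empty => simp
  | insert i s hi ih =>
    rw [Finset.sum_insert hi]
    exact (h i (Finset.mem_insert_self i s)).add
      (ih fun j hj => h j (Finset.mem_insert_of_mem hj))

/-- A face of a Minkowski sum determines its summands: this is why faces of a nestohedron can be
counted by the faces that they cut out of the individual simplices. -/
theorem toExposed_subset_of_sum_eq {E ι : Type*} [NormedAddCommGroup E] [NormedSpace ℝ E]
    (l l' : StrongDual ℝ E) (A : ι → Set E) (s : Finset ι)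
    (hne : ∀ i ∈ s, (l.toExposed (A i)).Nonempty)
    (h : ∑ i ∈ s, l.toExposed (A i) = ∑ i ∈ s, l'.toExposed (A i)) {j : ι} (hj : j ∈ s) :
    l.toExposed (A j) ⊆ l'.toExposed (A j) := by
  classical
  intro x hx
  obtain ⟨z, hz⟩ := nonempty_finsetSum (fun i => l.toExposed (A i)) (s.erase j)
    fun i hi => hne i (Finset.mem_of_mem_erase hi)
  have hmem : x + z ∈ ∑ i ∈ s, l'.toExposed (A i) := by
    rw [← h, ← Finset.add_sum_erase s _ hj]
    exact Set.add_mem_add hx hz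
  rw [← toExposed_sum, ← Finset.add_sum_erase s _ hj] at hmem
  rw [← toExposed_sum] at hz
  refine ⟨hx.1, fun y hy => ?_⟩
  have := hmem.2 (y + z) (Set.add_mem_add hy hz.1)
  simpa using this

theorem vectorSpan_add_set {E : Type*} [AddCommGroup E] [Module ℝ E] {A B : Set E}
    (hA : A.Nonempty) (hB : B.Nonempty) :
    vectorSpan ℝ (A + B) = vectorSpan ℝ A ⊔ vectorSpan ℝ B := by
  apply le_antisymm
  · rw [vectorSpan_def, Submodule.span_le]
    rintro _ ⟨_, ⟨a, ha, b, hb, rfl⟩, _, ⟨c, hc, d, hd, rfl⟩, rfl⟩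
    have : (a + b) -ᵥ (c + d) = (a -ᵥ c) + (b -ᵥ d) := by
      simp only [vsub_eq_sub]; abel
    simp only [this]
    exact Submodule.add_mem_sup (vsub_mem_vectorSpan ℝ ha hc) (vsub_mem_vectorSpan ℝ hb hd)
  · obtain ⟨a₀, ha₀⟩ := hA
    obtain ⟨b₀, hb₀⟩ := hB
    apply sup_le
    · rw [vectorSpan_def, Submodule.span_le]
      rintro _ ⟨a, ha, c, hc, rfl⟩
      have := vsub_mem_vectorSpan ℝ (Set.add_mem_add ha hb₀) (Set.add_mem_add hc hb₀)
      simpa using this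
    · rw [vectorSpan_def, Submodule.span_le]
      rintro _ ⟨a, ha, c, hc, rfl⟩
      have := vsub_mem_vectorSpan ℝ (Set.add_mem_add ha₀ ha) (Set.add_mem_add ha₀ hc)
      simpa using this

theorem vectorSpan_finsetSum {E ι : Type*} [AddCommGroup E] [Module ℝ E] (A : ι → Set E)
    (s : Finset ι) (h : ∀ i ∈ s, (A i).Nonempty) :
    vectorSpan ℝ (∑ i ∈ s, A i) = ⨆ i ∈ s, vectorSpan ℝ (A i) := by
  classical
  induction s using Finset.induction_on with
  | empty => simp [← Set.singleton_zero]
  | insert i s hi ih =>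
    have hs : ∀ j ∈ s, (A j).Nonempty := fun j hj => h j (Finset.mem_insert_of_mem hj)
    rw [Finset.sum_insert hi, vectorSpan_add_set (h i (Finset.mem_insert_self i s))
      (nonempty_finsetSum A s hs), ih hs, Finset.iSup_insert]

/-! ### Faces of coordinate simplices -/

theorem mem_coordinateSimplex {V : Type*} [Fintype V] [DecidableEq V] (S : Finset V)
    (x : V → ℝ) :
    x ∈ coordinateSimplex S ↔ (∀ i, 0 ≤ x i) ∧ (∀ i ∉ S, x i = 0) ∧ ∑ i, x i = 1 := by
  classical
  have hform : coordinateSimplex S =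
      convexHull ℝ ((fun i : V => (Pi.single i 1 : V → ℝ)) '' (S : Set V)) := by
    unfold coordinateSimplex
    congr!
  rw [hform]
  constructor
  · refine fun hx => convexHull_min (t := {x : V → ℝ | (∀ i, 0 ≤ x i) ∧ (∀ i ∉ S, x i = 0) ∧
      ∑ i, x i = 1}) ?_ ?_ hx
    · rintro _ ⟨i, hi, rfl⟩
      refine ⟨fun j => ?_, fun j hj => ?_, by simp⟩
      · by_cases h : j = i
        · subst h; simp
        · simp [h]
      · have : j ≠ i := by rintro rfl; exact hj hi
        simp [this]
    · rintro x ⟨hx0, hxS, hx1⟩ y ⟨hy0, hyS, hy1⟩ a b ha hb hab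
      refine ⟨fun i => ?_, fun i hi => ?_, ?_⟩
      · have := hx0 i
        have := hy0 i
        simp only [Pi.add_apply, Pi.smul_apply, smul_eq_mul]
        positivity
      · simp [hxS i hi, hyS i hi]
      · simp [Finset.sum_add_distrib, ← Finset.mul_sum, hx1, hy1, hab]
  · rintro ⟨h0, hS, h1⟩
    have hsum : ∑ i ∈ S, x i = 1 := by
      rw [← h1]
      exact Finset.sum_subset (Finset.subset_univ S) fun i _ hi => hS i hi
    have hx : x = ∑ i ∈ S, x i • (Pi.single i 1 : V → ℝ) := by
      ext j
      by_cases hj : j ∈ S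
      · simp [Finset.sum_apply, Pi.single_apply, hj]
      · simp [Finset.sum_apply, Pi.single_apply, hj, hS j hj]
    rw [hx]
    exact (convex_convexHull ℝ _).sum_mem (fun i _ => h0 i) hsum fun i hi =>
      subset_convexHull ℝ _ ⟨i, hi, rfl⟩

theorem single_mem_coordinateSimplex {V : Type*} [Fintype V] [DecidableEq V] (S : Finset V)
    (i : V) : (Pi.single i 1 : V → ℝ) ∈ coordinateSimplex S ↔ i ∈ S := by
  rw [mem_coordinateSimplex]
  constructor
  · rintro ⟨-, h, -⟩
    by_contra hi
    simpa using h i hi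
  · refine fun hi => ⟨fun j => ?_, fun j hj => ?_, by simp⟩
    · by_cases h : j = i
      · subst h; simp
      · simp [h]
    · have : j ≠ i := by rintro rfl; exact hj hi
      simp [this]

theorem coordinateSimplex_injective {V : Type*} [Fintype V] [DecidableEq V] :
    Function.Injective (coordinateSimplex : Finset V → Set (V → ℝ)) := by
  intro S T h
  ext i
  rw [← single_mem_coordinateSimplex, h, single_mem_coordinateSimplex]

theorem coordinateSimplex_nonempty {V : Type*} [Fintype V] [DecidableEq V] {S : Finset V}
    (hS : S.Nonempty) : (coordinateSimplex S).Nonempty :=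
  let ⟨i, hi⟩ := hS
  ⟨_, (single_mem_coordinateSimplex S i).2 hi⟩

/-- The elements of `S` at which the weight `w` is largest. -/
def maximizers {V : Type*} (w : V → ℝ) (S : Finset V) : Finset V :=
  S.filter fun i => ∀ j ∈ S, w j ≤ w i

theorem maximizers_subset {V : Type*} (w : V → ℝ) (S : Finset V) : maximizers w S ⊆ S :=
  Finset.filter_subset _ _

theorem mem_maximizers {V : Type*} {w : V → ℝ} {S : Finset V} {i : V} :
    i ∈ maximizers w S ↔ i ∈ S ∧ ∀ j ∈ S, w j ≤ w i := Finset.mem_filter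

theorem maximizers_nonempty {V : Type*} (w : V → ℝ) {S : Finset V} (hS : S.Nonempty) :
    (maximizers w S).Nonempty := by
  obtain ⟨i, hi, h⟩ := S.exists_max_image w hS
  exact ⟨i, mem_maximizers.2 ⟨hi, h⟩⟩

theorem maximizers_congr {V : Type*} {w w' : V → ℝ} {S : Finset V} (h : ∀ i ∈ S, w i = w' i) :
    maximizers w S = maximizers w' S := by
  ext i
  simp only [mem_maximizers]
  refine and_congr_right fun hi => forall₂_congr fun j hj => ?_
  rw [h i hi, h j hj]

/-- The linear functional on `V → ℝ` with coefficients `w`. -/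
def weightFunctional {V : Type*} [Fintype V] (w : V → ℝ) : StrongDual ℝ (V → ℝ) :=
  ∑ i, w i • ContinuousLinearMap.proj (R := ℝ) (φ := fun _ : V => ℝ) i

theorem weightFunctional_apply {V : Type*} [Fintype V] (w x : V → ℝ) :
    weightFunctional w x = ∑ i, w i * x i := by
  simp [weightFunctional]

theorem exists_weightFunctional_eq {V : Type*} [Fintype V] [DecidableEq V]
    (l : StrongDual ℝ (V → ℝ)) : ∃ w, weightFunctional w = l := by
  refine ⟨fun i => l (Pi.single i 1), ?_⟩
  ext x
  rw [weightFunctional_apply]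
  have hx : x = ∑ i, x i • (Pi.single i 1 : V → ℝ) := by
    ext j
    simp [Finset.sum_apply, Pi.single_apply]
  conv_rhs => rw [hx, map_sum]
  simp [mul_comm]

theorem toExposed_coordinateSimplex {V : Type*} [Fintype V] [DecidableEq V] (w : V → ℝ)
    (S : Finset V) :
    (weightFunctional w).toExposed (coordinateSimplex S) =
      coordinateSimplex (maximizers w S) := by
  rcases S.eq_empty_or_nonempty with rfl | hS
  · have h1 : maximizers w (∅ : Finset V) = ∅ := by simp [maximizers]
    have h2 : coordinateSimplex (∅ : Finset V) = ∅ := by simp [coordinateSimplex]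
    rw [h1, h2]
    simp [ContinuousLinearMap.toExposed]
  obtain ⟨k, hk⟩ := maximizers_nonempty w hS
  rw [mem_maximizers] at hk
  -- On the simplex the functional falls short of its largest value `w k` by this weighted sum
  -- of non-negative terms.
  have hval : ∀ x ∈ coordinateSimplex S,
      w k - weightFunctional w x = ∑ i ∈ S, (w k - w i) * x i := by
    intro x hx
    rw [mem_coordinateSimplex] at hx
    have h1 : ∑ i ∈ S, x i = 1 := by
      rw [← hx.2.2]
      exact Finset.sum_subset (Finset.subset_univ S) fun i _ hi => hx.2.1 i hi
    have h2 : weightFunctional w x = ∑ i ∈ S, w i * x i := by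
      rw [weightFunctional_apply]
      exact (Finset.sum_subset (Finset.subset_univ S) fun i _ hi => by simp [hx.2.1 i hi]).symm
    simp only [sub_mul, Finset.sum_sub_distrib, ← Finset.mul_sum, h1, h2, mul_one]
  have hterm : ∀ x ∈ coordinateSimplex S, ∀ i ∈ S, 0 ≤ (w k - w i) * x i := by
    intro x hx i hi
    exact mul_nonneg (sub_nonneg.2 (hk.2 i hi)) (((mem_coordinateSimplex S x).1 hx).1 i)
  ext x
  constructor
  · rintro ⟨hx, hmax⟩
    have h0 : ∑ i ∈ S, (w k - w i) * x i = 0 := by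
      apply le_antisymm
      · rw [← hval x hx]
        have := hmax _ ((single_mem_coordinateSimplex S k).2 hk.1)
        rw [weightFunctional_apply] at this
        simp [Pi.single_apply] at this
        linarith
      · exact Finset.sum_nonneg (hterm x hx)
    rw [Finset.sum_eq_zero_iff_of_nonneg (hterm x hx)] at h0
    have hx' := (mem_coordinateSimplex S x).1 hx
    refine (mem_coordinateSimplex _ x).2 ⟨hx'.1, fun i hi => ?_, hx'.2.2⟩
    by_cases hiS : i ∈ S
    · rcases mul_eq_zero.1 (h0 i hiS) with h | h
      · refine absurd (mem_maximizers.2 ⟨hiS, fun j hj => ?_⟩) hi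
        have := hk.2 j hj
        linarith
      · exact h
    · exact hx'.2.1 i hiS
  · intro hx
    rw [mem_coordinateSimplex] at hx
    have hxS : x ∈ coordinateSimplex S :=
      (mem_coordinateSimplex S x).2
        ⟨hx.1, fun i hi => hx.2.1 i fun h => hi (maximizers_subset w S h), hx.2.2⟩
    refine ⟨hxS, fun y hy => ?_⟩
    have h0 : ∑ i ∈ S, (w k - w i) * x i = 0 := by
      refine Finset.sum_eq_zero fun i hi => ?_
      by_cases hm : i ∈ maximizers w S
      · have : w k = w i := le_antisymm ((mem_maximizers.1 hm).2 k hk.1) (hk.2 i hi)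
        simp [this]
      · simp [hx.2.1 i hm]
    have h1 := hval x hxS
    have h2 := hval y hy
    have h3 := Finset.sum_nonneg (hterm y hy)
    linarith

/-- The direction of the simplex `Δ_S`: the span of the differences `e_i - e_j` with
`i, j ∈ S`. -/
def simplexDirection {V : Type*} [DecidableEq V] (S : Finset V) : Submodule ℝ (V → ℝ) :=
  vectorSpan ℝ ((fun i : V => (Pi.single i 1 : V → ℝ)) '' (S : Set V))

theorem vectorSpan_coordinateSimplex {V : Type*} [DecidableEq V] (S : Finset V) :
    vectorSpan ℝ (coordinateSimplex S) = simplexDirection S := by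
  unfold coordinateSimplex simplexDirection
  rw [← direction_affineSpan, affineSpan_convexHull, direction_affineSpan]
  congr!

theorem simplexDirection_mono {V : Type*} [DecidableEq V] {S T : Finset V} (h : S ⊆ T) :
    simplexDirection S ≤ simplexDirection T :=
  vectorSpan_mono ℝ (Set.image_mono (by exact_mod_cast h))

theorem simplexDirection_empty {V : Type*} [DecidableEq V] :
    simplexDirection (∅ : Finset V) = ⊥ := by
  simp [simplexDirection]

theorem simplexDirection_singleton {V : Type*} [DecidableEq V] (i : V) :
    simplexDirection ({i} : Finset V) = ⊥ := by
  simp [simplexDirection]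

theorem finrank_simplexDirection {V : Type*} [Fintype V] [DecidableEq V] {S : Finset V}
    (hS : S.Nonempty) : Module.finrank ℝ (simplexDirection S) = S.card - 1 := by
  have hind : AffineIndependent ℝ (fun i : V => (Pi.single i 1 : V → ℝ)) :=
    (Pi.linearIndependent_single_one V ℝ).affineIndependent
  have hc : S.card = (S.card - 1) + 1 := by
    have := hS.card_pos
    omega
  have := hind.finrank_vectorSpan_image_finset hc
  rwa [Finset.coe_image] at this

/-- The vectors whose coordinates outside `S` vanish. -/
def supportedOn {V : Type*} (S : Finset V) : Submodule ℝ (V → ℝ) :=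
  ⨅ i ∈ ((S : Set V)ᶜ), LinearMap.ker (LinearMap.proj (R := ℝ) (φ := fun _ : V => ℝ) i)

theorem mem_supportedOn {V : Type*} {S : Finset V} {x : V → ℝ} :
    x ∈ supportedOn S ↔ ∀ i ∉ S, x i = 0 := by
  simp [supportedOn]

theorem simplexDirection_le_supportedOn {V : Type*} [DecidableEq V] {S T : Finset V}
    (h : S ⊆ T) : simplexDirection S ≤ supportedOn T := by
  unfold simplexDirection
  rw [vectorSpan_def, Submodule.span_le]
  rintro _ ⟨_, ⟨i, hi, rfl⟩, _, ⟨j, hj, rfl⟩, rfl⟩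
  refine mem_supportedOn.2 fun k hk => ?_
  have hki : k ≠ i := by rintro rfl; exact hk (h hi)
  have hkj : k ≠ j := by rintro rfl; exact hk (h hj)
  simp [hki, hkj]

theorem disjoint_supportedOn {V : Type*} {S T : Finset V} (h : Disjoint S T) :
    Disjoint (supportedOn S) (supportedOn T) := by
  rw [Submodule.disjoint_def]
  intro x hS hT
  rw [mem_supportedOn] at hS hT
  ext i
  by_cases hi : i ∈ S
  · exact hT i (Finset.disjoint_left.1 h hi)
  · exact hS i hi

theorem finrank_supportedOn_le {V : Type*} [Fintype V] (S : Finset V) :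
    Module.finrank ℝ (supportedOn S) ≤ S.card := by
  classical
  have hle : supportedOn S ≤
      Submodule.span ℝ ((S.image fun i : V => (Pi.single i 1 : V → ℝ) : Finset (V → ℝ)) :
        Set (V → ℝ)) := by
    intro x hx
    rw [mem_supportedOn] at hx
    have hx' : x = ∑ i ∈ S, x i • (Pi.single i 1 : V → ℝ) := by
      ext j
      by_cases hj : j ∈ S
      · simp [Finset.sum_apply, Pi.single_apply, hj]
      · simp [Finset.sum_apply, Pi.single_apply, hj, hx j hj]
    rw [hx']
    exact Submodule.sum_mem _ fun i hi => Submodule.smul_mem _ _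
      (Submodule.subset_span (by simpa using ⟨i, hi, rfl⟩))
  exact (Submodule.finrank_mono hle).trans
    ((finrank_span_finset_le_card _).trans Finset.card_image_le)

/-! ### Face patterns of nestohedra -/

/-- The face pattern of the weight `w` for the building set `B` restricted to `U`: it sends every
`S ∈ B` with `S ⊆ U` to the set of maximizers of `w` on `S`, and all other sets to `∅`. -/
def facePattern {V : Type*} [DecidableEq V] (B : Finset (Finset V)) (U : Finset V) (w : V → ℝ) :
    Finset V → Finset V :=
  fun S => if S ∈ B ∧ S ⊆ U then maximizers w S else ∅

/-- All face patterns of `B` restricted to `U`. -/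
def facePatterns {V : Type*} [Fintype V] [DecidableEq V] (B : Finset (Finset V))
    (U : Finset V) : Finset (Finset V → Finset V) :=
  (Set.toFinite (Set.range (facePattern B U))).toFinset

theorem mem_facePatterns {V : Type*} [Fintype V] [DecidableEq V] {B : Finset (Finset V)}
    {U : Finset V} {a : Finset V → Finset V} :
    a ∈ facePatterns B U ↔ ∃ w, facePattern B U w = a := by
  simp [facePatterns]

/-- The dimension of the face `∑ Δ_{a S}` given by a pattern `a`. -/
def patternDim {V : Type*} [DecidableEq V] (a : Finset V → Finset V) : ℕ :=
  Module.finrank ℝ (⨆ S, simplexDirection (a S) : Submodule ℝ (V → ℝ))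

/-- The face of the nestohedron at which the functional with coefficients `w` is largest. -/
def nestohedronFace {V : Type*} [Fintype V] (B : Finset (Finset V)) (w : V → ℝ) :
    Set (V → ℝ) :=
  (weightFunctional w).toExposed (nestohedron B)

theorem nestohedronFace_eq_sum {V : Type*} [Fintype V] [DecidableEq V] (B : Finset (Finset V))
    (w : V → ℝ) : nestohedronFace B w = ∑ S ∈ B, coordinateSimplex (maximizers w S) := by
  simp only [nestohedronFace, nestohedron, toExposed_sum, toExposed_coordinateSimplex]

theorem nestohedronFace_nonempty {V : Type*} [Fintype V] [DecidableEq V]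
    {B : Finset (Finset V)} (hB : ∀ S ∈ B, S.Nonempty) (w : V → ℝ) :
    (nestohedronFace B w).Nonempty := by
  rw [nestohedronFace_eq_sum]
  exact nonempty_finsetSum _ _ fun S hS =>
    coordinateSimplex_nonempty (maximizers_nonempty w (hB S hS))

theorem polytopeDim_nestohedronFace {V : Type*} [Fintype V] [DecidableEq V]
    {B : Finset (Finset V)} (hB : ∀ S ∈ B, S.Nonempty) (w : V → ℝ) :
    polytopeDim (nestohedronFace B w) = patternDim (facePattern B Finset.univ w) := by
  have hspan := (vectorSpan_finsetSum (fun S => coordinateSimplex (maximizers w S)) B fun S hS =>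
    coordinateSimplex_nonempty (maximizers_nonempty w (hB S hS))).trans
      (iSup_congr (g := fun S => simplexDirection (facePattern B Finset.univ w S)) fun S => by
        by_cases hS : S ∈ B
        · simp only [facePattern, hS, Finset.subset_univ, and_self, if_true, iSup_pos]
          exact vectorSpan_coordinateSimplex _
        · simp [facePattern, hS, simplexDirection_empty])
  rw [polytopeDim, nestohedronFace_eq_sum]
  exact congrArg (fun W : Submodule ℝ (V → ℝ) => Module.finrank ℝ W) hspan

theorem nestohedronFace_zero {V : Type*} [Fintype V] (B : Finset (Finset V)) :
    nestohedronFace B 0 = nestohedron B := by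
  ext x
  simp [nestohedronFace, ContinuousLinearMap.toExposed, weightFunctional_apply]

theorem nestohedronFace_eq_iff {V : Type*} [Fintype V] [DecidableEq V]
    {B : Finset (Finset V)} (hB : ∀ S ∈ B, S.Nonempty) (w w' : V → ℝ) :
    nestohedronFace B w = nestohedronFace B w' ↔
      facePattern B Finset.univ w = facePattern B Finset.univ w' := by
  constructor
  · intro h
    ext1 S
    by_cases hS : S ∈ B
    · simp only [facePattern, hS, Finset.subset_univ, and_self, if_true]
      have hne : ∀ v : V → ℝ, ∀ T ∈ B,
          ((weightFunctional v).toExposed (coordinateSimplex T)).Nonempty := by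
        intro v T hT
        rw [toExposed_coordinateSimplex]
        exact coordinateSimplex_nonempty (maximizers_nonempty v (hB T hT))
      have h' : ∑ T ∈ B, (weightFunctional w).toExposed (coordinateSimplex T) =
          ∑ T ∈ B, (weightFunctional w').toExposed (coordinateSimplex T) := by
        rw [← toExposed_sum, ← toExposed_sum]
        exact h
      apply coordinateSimplex_injective
      rw [← toExposed_coordinateSimplex, ← toExposed_coordinateSimplex]
      exact (toExposed_subset_of_sum_eq _ _ _ B (hne w) h' hS).antisymm
        (toExposed_subset_of_sum_eq _ _ _ B (hne w') h'.symm hS)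
    · simp [facePattern, hS]
  · intro h
    rw [nestohedronFace_eq_sum, nestohedronFace_eq_sum]
    refine Finset.sum_congr rfl fun S hS => ?_
    have := congrFun h S
    simp only [facePattern, hS, Finset.subset_univ, and_self, if_true] at this
    rw [this]

theorem faceCount_nestohedron {V : Type*} [Fintype V] [DecidableEq V]
    {B : Finset (Finset V)} (hB : ∀ S ∈ B, S.Nonempty) (i : ℕ) :
    faceCount (nestohedron B) i =
      ((facePatterns B Finset.univ).filter fun a => patternDim a = i).card := by
  unfold faceCount
  rw [← Set.ncard_coe_finset]
  have hex : ∀ a ∈ (((facePatterns B Finset.univ).filter fun a => patternDim a = i :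
      Finset (Finset V → Finset V)) : Set (Finset V → Finset V)),
      ∃ w, facePattern B Finset.univ w = a := fun a ha =>
    mem_facePatterns.1 (Finset.mem_filter.1 (Finset.mem_coe.1 ha)).1
  symm
  refine Set.ncard_congr (fun a ha => nestohedronFace B (hex a ha).choose) ?_ ?_ ?_
  · intro a ha
    refine ⟨ContinuousLinearMap.toExposed.isExposed, nestohedronFace_nonempty hB _, ?_⟩
    rw [polytopeDim_nestohedronFace hB, (hex a ha).choose_spec]
    exact (Finset.mem_filter.1 (Finset.mem_coe.1 ha)).2
  · intro a b ha hb h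
    rw [nestohedronFace_eq_iff hB, (hex a ha).choose_spec, (hex b hb).choose_spec] at h
    exact h
  · rintro F ⟨hF, hne, hdim⟩
    obtain ⟨l, hl⟩ := hF hne
    obtain ⟨w, rfl⟩ := exists_weightFunctional_eq l
    have hF' : F = nestohedronFace B w := hl
    have hmem : facePattern B Finset.univ w ∈ (((facePatterns B Finset.univ).filter
        fun a => patternDim a = i : Finset (Finset V → Finset V)) :
          Set (Finset V → Finset V)) := by
      refine Finset.mem_coe.2 (Finset.mem_filter.2 ⟨mem_facePatterns.2 ⟨w, rfl⟩, ?_⟩)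
      rw [← polytopeDim_nestohedronFace hB, ← hF', hdim]
    refine ⟨_, hmem, ?_⟩
    rw [hF', nestohedronFace_eq_iff hB, (hex _ hmem).choose_spec]

theorem patternDim_le_card {V : Type*} [Fintype V] [DecidableEq V] {B : Finset (Finset V)}
    {U : Finset V} {a : Finset V → Finset V} (ha : a ∈ facePatterns B U) :
    patternDim a ≤ U.card := by
  obtain ⟨w, rfl⟩ := mem_facePatterns.1 ha
  refine (Submodule.finrank_mono (iSup_le fun S => simplexDirection_le_supportedOn ?_)).trans
    (finrank_supportedOn_le U)
  unfold facePattern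
  split_ifs with h
  · exact (maximizers_subset w S).trans h.2
  · simp

/-- The pattern on `U` whose top level set is `M` and which continues below `M` as `b`. -/
def gluePattern {V : Type*} [DecidableEq V] (B : Finset (Finset V)) (U M : Finset V)
    (b : Finset V → Finset V) : Finset V → Finset V :=
  fun S => if S ∈ B ∧ S ⊆ U then (if (S ∩ M).Nonempty then S ∩ M else b S) else ∅

/-- The restriction of a pattern to the sets of `B` inside `U`. -/
def restrictPattern {V : Type*} [DecidableEq V] (B : Finset (Finset V)) (U : Finset V)
    (a : Finset V → Finset V) : Finset V → Finset V :=
  fun S => if S ∈ B ∧ S ⊆ U then a S else ∅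

theorem restrictPattern_facePattern {V : Type*} [DecidableEq V] (B : Finset (Finset V))
    {U U' : Finset V} (h : U' ⊆ U) (w : V → ℝ) :
    restrictPattern B U' (facePattern B U w) = facePattern B U' w := by
  ext1 S
  unfold restrictPattern facePattern
  by_cases h1 : S ∈ B ∧ S ⊆ U'
  · rw [if_pos h1, if_pos ⟨h1.1, h1.2.trans h⟩, if_pos h1]
  · rw [if_neg h1, if_neg h1]

theorem maximizers_eq_inter {V : Type*} [DecidableEq V] {w : V → ℝ} {S U : Finset V}
    (hSU : S ⊆ U) (h : (S ∩ maximizers w U).Nonempty) :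
    maximizers w S = S ∩ maximizers w U := by
  obtain ⟨k, hk⟩ := h
  rw [Finset.mem_inter, mem_maximizers] at hk
  ext i
  rw [Finset.mem_inter, mem_maximizers, mem_maximizers]
  constructor
  · rintro ⟨hi, hmax⟩
    exact ⟨hi, hSU hi, fun j hj => (hk.2.2 j hj).trans (hmax k hk.1)⟩
  · rintro ⟨hi, -, hmax⟩
    exact ⟨hi, fun j hj => hmax j (hSU hj)⟩

theorem subset_sdiff_of_not_nonempty_inter {V : Type*} [DecidableEq V] {S U M : Finset V}
    (hSU : S ⊆ U) (h : ¬ (S ∩ M).Nonempty) : S ⊆ U \ M := by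
  intro i hi
  refine Finset.mem_sdiff.2 ⟨hSU hi, fun hM => h ⟨i, Finset.mem_inter.2 ⟨hi, hM⟩⟩⟩

theorem facePattern_eq_gluePattern {V : Type*} [DecidableEq V] (B : Finset (Finset V))
    (U : Finset V) (w : V → ℝ) :
    facePattern B U w =
      gluePattern B U (maximizers w U) (facePattern B (U \ maximizers w U) w) := by
  ext1 S
  unfold gluePattern
  conv_lhs => unfold facePattern
  by_cases h1 : S ∈ B ∧ S ⊆ U
  · rw [if_pos h1, if_pos h1]
    by_cases h2 : (S ∩ maximizers w U).Nonempty
    · rw [if_pos h2, maximizers_eq_inter h1.2 h2]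
    · rw [if_neg h2, facePattern, if_pos ⟨h1.1, subset_sdiff_of_not_nonempty_inter h1.2 h2⟩]
  · rw [if_neg h1, if_neg h1]

theorem exists_maximizers_eq {V : Type*} [Fintype V] [DecidableEq V] {U M : Finset V}
    (hMU : M ⊆ U) (hM : M.Nonempty) (w : V → ℝ) :
    ∃ w' : V → ℝ, maximizers w' U = M ∧ ∀ i ∈ U \ M, w' i = w i := by
  obtain ⟨c, hc⟩ : ∃ c : ℝ, ∀ i, w i < c := by
    refine ⟨1 + ∑ i, |w i|, fun i => ?_⟩
    have := Finset.single_le_sum (fun j _ => abs_nonneg (w j)) (Finset.mem_univ i)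
    have := le_abs_self (w i)
    linarith
  refine ⟨fun i => if i ∈ M then c else w i, ?_, fun i hi => if_neg (Finset.mem_sdiff.1 hi).2⟩
  ext i
  rw [mem_maximizers]
  constructor
  · rintro ⟨-, h⟩
    obtain ⟨k, hk⟩ := hM
    have := h k (hMU hk)
    by_contra hi
    simp only [hk, hi, if_true, if_false] at this
    exact absurd this (not_le.2 (hc i))
  · intro hi
    refine ⟨hMU hi, fun j _ => ?_⟩
    simp only [hi, if_true]
    split_ifs
    · exact le_rfl
    · exact (hc j).le

theorem gluePattern_mem_facePatterns {V : Type*} [Fintype V] [DecidableEq V]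
    {B : Finset (Finset V)} {U M : Finset V} (hMU : M ⊆ U) (hM : M.Nonempty)
    {b : Finset V → Finset V} (hb : b ∈ facePatterns B (U \ M)) :
    gluePattern B U M b ∈ facePatterns B U := by
  obtain ⟨w, rfl⟩ := mem_facePatterns.1 hb
  obtain ⟨w', h1, h2⟩ := exists_maximizers_eq hMU hM w
  refine mem_facePatterns.2 ⟨w', ?_⟩
  rw [facePattern_eq_gluePattern, h1]
  congr 1
  ext1 S
  unfold facePattern
  split_ifs with h
  · exact maximizers_congr fun i hi => h2 i (h.2 hi)
  · rfl

theorem gluePattern_apply_self {V : Type*} [DecidableEq V] {B : Finset (Finset V)}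
    {U M : Finset V} (hU : U ∈ B) (hMU : M ⊆ U) (hM : M.Nonempty) (b : Finset V → Finset V) :
    gluePattern B U M b U = M := by
  have : U ∩ M = M := Finset.inter_eq_right.2 hMU
  simp [gluePattern, hU, this, hM]

theorem restrictPattern_gluePattern {V : Type*} [Fintype V] [DecidableEq V]
    {B : Finset (Finset V)} {U M : Finset V} {b : Finset V → Finset V}
    (hb : b ∈ facePatterns B (U \ M)) :
    restrictPattern B (U \ M) (gluePattern B U M b) = b := by
  obtain ⟨w, rfl⟩ := mem_facePatterns.1 hb
  ext1 S
  unfold restrictPattern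
  split_ifs with h
  · have h2 : ¬ (S ∩ M).Nonempty := by
      rintro ⟨i, hi⟩
      rw [Finset.mem_inter] at hi
      exact (Finset.mem_sdiff.1 (h.2 hi.1)).2 hi.2
    rw [gluePattern, if_pos ⟨h.1, h.2.trans Finset.sdiff_subset⟩, if_neg h2]
  · rw [facePattern, if_neg h]

theorem patternDim_gluePattern {V : Type*} [Fintype V] [DecidableEq V]
    {B : Finset (Finset V)} {U M : Finset V} (hU : U ∈ B) (hMU : M ⊆ U) (hM : M.Nonempty)
    {b : Finset V → Finset V} (hb : b ∈ facePatterns B (U \ M)) :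
    patternDim (gluePattern B U M b) = M.card - 1 + patternDim b := by
  obtain ⟨w, rfl⟩ := mem_facePatterns.1 hb
  set b := facePattern B (U \ M) w with hbdef
  have hbS : ∀ S, b S ⊆ U \ M := by
    intro S
    rw [hbdef, facePattern]
    split_ifs with h
    · exact (maximizers_subset w S).trans h.2
    · simp
  have hsup : (⨆ S, simplexDirection (gluePattern B U M b S)) =
      simplexDirection M ⊔ ⨆ S, simplexDirection (b S) := by
    apply le_antisymm
    · refine iSup_le fun S => ?_
      unfold gluePattern
      split_ifs with h1 h2
      · exact (simplexDirection_mono Finset.inter_subset_right).trans le_sup_left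
      · exact (le_iSup (fun S => simplexDirection (b S)) S).trans le_sup_right
      · simp [simplexDirection_empty]
    · refine sup_le ?_ (iSup_le fun S => ?_)
      · have := le_iSup (fun S => simplexDirection (gluePattern B U M b S)) U
        rwa [gluePattern_apply_self hU hMU hM] at this
      · have h3 : b S ⊆ gluePattern B U M b S := by
          have := congrFun (restrictPattern_gluePattern hb) S
          rw [← this, restrictPattern]
          split_ifs
          · exact subset_rfl
          · simp
        exact (simplexDirection_mono h3).trans
          (le_iSup (fun S => simplexDirection (gluePattern B U M b S)) S)
  have hdisj : Disjoint (simplexDirection M) (⨆ S, simplexDirection (b S)) :=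
    (disjoint_supportedOn (Finset.disjoint_sdiff (s := M) (t := U))).mono
      (simplexDirection_le_supportedOn subset_rfl)
      (iSup_le fun S => simplexDirection_le_supportedOn (hbS S))
  have := Submodule.finrank_sup_add_finrank_inf_eq (simplexDirection M)
    (⨆ S, simplexDirection (b S))
  rw [hdisj.eq_bot, finrank_bot, add_zero, finrank_simplexDirection hM] at this
  rw [patternDim, hsup, this, patternDim]

/-- The face enumerator `∑ u ^ dim a * v ^ (#U - dim a)` over the face patterns `a` of `B`
restricted to `U`. For `U ∈ B` this is `v` times the homogeneous `f`-polynomial, at `(u, v)`, of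
the nestohedron of the restriction; the extra factor makes the enumerator multiplicative over
connected components. -/
def faceEnumerator {V R : Type*} [Fintype V] [DecidableEq V] [CommSemiring R] (u v : R)
    (B : Finset (Finset V)) (U : Finset V) : R :=
  ∑ a ∈ facePatterns B U, u ^ patternDim a * v ^ (U.card - patternDim a)

/-- A face is given by the top level set `M` of its weight and a face pattern on what is left. -/
theorem faceEnumerator_eq_sum {V R : Type*} [Fintype V] [DecidableEq V] [CommSemiring R]
    (u v : R) {B : Finset (Finset V)} {U : Finset V} (hU : U ∈ B) (hne : U.Nonempty) :
    faceEnumerator u v B U = ∑ M ∈ U.powerset with M.Nonempty,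
      u ^ (M.card - 1) * v * faceEnumerator u v B (U \ M) := by
  unfold faceEnumerator
  simp only [Finset.mul_sum]
  rw [Finset.sum_sigma']
  symm
  refine Finset.sum_bij' (fun p _ => gluePattern B U p.1 p.2)
    (fun a _ => ⟨a U, restrictPattern B (U \ a U) a⟩) ?_ ?_ ?_ ?_ ?_
  · rintro ⟨M, b⟩ h
    simp only [Finset.mem_sigma, Finset.mem_filter, Finset.mem_powerset] at h
    exact gluePattern_mem_facePatterns h.1.1 h.1.2 h.2
  · intro a ha
    obtain ⟨w, rfl⟩ := mem_facePatterns.1 ha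
    have hw : facePattern B U w U = maximizers w U := by simp [facePattern, hU]
    simp only [Finset.mem_sigma, Finset.mem_filter, Finset.mem_powerset, hw]
    refine ⟨⟨maximizers_subset w U, maximizers_nonempty w hne⟩, ?_⟩
    rw [restrictPattern_facePattern B Finset.sdiff_subset]
    exact mem_facePatterns.2 ⟨w, rfl⟩
  · rintro ⟨M, b⟩ h
    simp only [Finset.mem_sigma, Finset.mem_filter, Finset.mem_powerset] at h
    simp only [gluePattern_apply_self hU h.1.1 h.1.2, restrictPattern_gluePattern h.2]
  · intro a ha
    obtain ⟨w, rfl⟩ := mem_facePatterns.1 ha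
    have hw : facePattern B U w U = maximizers w U := by simp [facePattern, hU]
    simp only [hw]
    rw [restrictPattern_facePattern B Finset.sdiff_subset, ← facePattern_eq_gluePattern]
  · rintro ⟨M, b⟩ h
    simp only [Finset.mem_sigma, Finset.mem_filter, Finset.mem_powerset] at h
    simp only [patternDim_gluePattern hU h.1.1 h.1.2 h.2]
    have h1 := patternDim_le_card h.2
    have h2 := Finset.card_sdiff_of_subset h.1.1
    have h3 := h.1.2.card_pos
    have h4 := Finset.card_le_card h.1.1
    have h5 : U.card - (M.card - 1 + patternDim b) = (U \ M).card - patternDim b + 1 := by omega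
    rw [h5]
    ring

theorem faceEnumerator_of_forall_singleton {V R : Type*} [Fintype V] [DecidableEq V]
    [CommSemiring R] (u v : R) {B : Finset (Finset V)} {U : Finset V}
    (h : ∀ S ∈ B, S ⊆ U → ∃ i, S = {i}) : faceEnumerator u v B U = v ^ U.card := by
  have hpat : ∀ w, facePattern B U w = fun S => if S ∈ B ∧ S ⊆ U then S else ∅ := by
    intro w
    ext1 S
    unfold facePattern
    split_ifs with hS
    · obtain ⟨i, rfl⟩ := h S hS.1 hS.2
      ext j
      simp only [mem_maximizers, Finset.mem_singleton]
      constructor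
      · exact fun hj => hj.1
      · rintro rfl
        simp
    · rfl
  have hset : facePatterns B U = {fun S => if S ∈ B ∧ S ⊆ U then S else ∅} := by
    ext a
    rw [mem_facePatterns, Finset.mem_singleton]
    constructor
    · rintro ⟨w, rfl⟩
      exact hpat w
    · rintro rfl
      exact ⟨0, hpat 0⟩
  have hdim : patternDim (fun S => if S ∈ B ∧ S ⊆ U then S else ∅) = 0 := by
    have : (⨆ S : Finset V, simplexDirection (if S ∈ B ∧ S ⊆ U then S else ∅)) = ⊥ := by
      rw [iSup_eq_bot]
      intro S
      split_ifs with hS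
      · obtain ⟨i, rfl⟩ := h S hS.1 hS.2
        exact simplexDirection_singleton i
      · exact simplexDirection_empty
    rw [patternDim, this, finrank_bot]
  simp [faceEnumerator, hset, hdim]

/-! ### The `h`-polynomial of a nestohedron -/

theorem patternDim_zero_weight {V : Type*} [Fintype V] [DecidableEq V] [Nonempty V]
    {B : Finset (Finset V)} (hV : Finset.univ ∈ B) :
    patternDim (facePattern B Finset.univ 0) = Fintype.card V - 1 := by
  have h0 : maximizers (0 : V → ℝ) Finset.univ = Finset.univ := by ext i; simp [mem_maximizers]
  rw [facePattern_eq_gluePattern, patternDim_gluePattern hV (maximizers_subset _ _)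
    (maximizers_nonempty _ Finset.univ_nonempty) (mem_facePatterns.2 ⟨0, rfl⟩), h0]
  have h1 : patternDim (facePattern B (Finset.univ \ Finset.univ) 0) ≤ 0 := by
    simpa using patternDim_le_card (mem_facePatterns.2
      ⟨(0 : V → ℝ), rfl⟩ : facePattern B (Finset.univ \ Finset.univ) 0 ∈ facePatterns B _)
  rw [Nat.le_zero.1 h1]
  simp

theorem polytopeDim_nestohedron {V : Type*} [Fintype V] [DecidableEq V] [Nonempty V]
    {B : Finset (Finset V)} (hB : ∀ S ∈ B, S.Nonempty) (hV : Finset.univ ∈ B) :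
    polytopeDim (nestohedron B) = Fintype.card V - 1 := by
  rw [← nestohedronFace_zero, polytopeDim_nestohedronFace hB, patternDim_zero_weight hV]

theorem hPolynomial_eq_sum {E : Type*} [NormedAddCommGroup E] [NormedSpace ℝ E] (P : Set E) :
    hPolynomial P = ∑ i ∈ Finset.range (polytopeDim P + 1),
      MvPolynomial.C (faceCount P i : ℚ) * (MvPolynomial.X 0 - MvPolynomial.X 1) ^ i *
        MvPolynomial.X 1 ^ (polytopeDim P - i) := by
  simp [hPolynomial, fPolynomial, map_sum]

theorem isHomogeneous_hPolynomial {E : Type*} [NormedAddCommGroup E] [NormedSpace ℝ E]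
    (P : Set E) : (hPolynomial P).IsHomogeneous (polytopeDim P) := by
  rw [hPolynomial_eq_sum]
  refine MvPolynomial.IsHomogeneous.sum _ _ _ fun i hi => ?_
  have hi' : i ≤ polytopeDim P := Nat.lt_succ_iff.1 (Finset.mem_range.1 hi)
  have h1 := (((MvPolynomial.isHomogeneous_X ℚ (0 : Fin 2)).sub
    (MvPolynomial.isHomogeneous_X ℚ 1)).pow i)
  have h2 := (MvPolynomial.isHomogeneous_X ℚ (1 : Fin 2)).pow (polytopeDim P - i)
  have h3 := ((MvPolynomial.isHomogeneous_C (Fin 2) (faceCount P i : ℚ)).mul h1).mul h2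
  convert h3 using 1
  omega

theorem X_mul_hPolynomial_nestohedron {V : Type*} [Fintype V] [DecidableEq V] [Nonempty V]
    {B : Finset (Finset V)} (hB : ∀ S ∈ B, S.Nonempty) (hV : Finset.univ ∈ B) :
    MvPolynomial.X 1 * hPolynomial (nestohedron B) =
      faceEnumerator (MvPolynomial.X 0 - MvPolynomial.X 1 : MvPolynomial (Fin 2) ℚ)
        (MvPolynomial.X 1) B Finset.univ := by
  have hle : ∀ a ∈ facePatterns B Finset.univ, patternDim a ≤ Fintype.card V - 1 := by
    intro a ha
    obtain ⟨w, rfl⟩ := mem_facePatterns.1 ha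
    rw [← polytopeDim_nestohedron hB hV, ← polytopeDim_nestohedronFace hB]
    exact Submodule.finrank_mono (vectorSpan_mono ℝ fun x hx => hx.1)
  rw [hPolynomial_eq_sum, polytopeDim_nestohedron hB hV, faceEnumerator,
    ← Finset.sum_fiberwise_of_maps_to (g := patternDim)
      (t := Finset.range (Fintype.card V - 1 + 1))
      fun a ha => Finset.mem_range.2 (Nat.lt_succ_of_le (hle a ha)), Finset.mul_sum]
  refine Finset.sum_congr rfl fun i hi => ?_
  have hi' : i ≤ Fintype.card V - 1 := Nat.lt_succ_iff.1 (Finset.mem_range.1 hi)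
  have hpos : 0 < Fintype.card V := Fintype.card_pos
  have hexp : Fintype.card V - i = Fintype.card V - 1 - i + 1 := by omega
  rw [faceCount_nestohedron hB, Finset.sum_congr rfl (g := fun _ =>
    (MvPolynomial.X 0 - MvPolynomial.X 1 : MvPolynomial (Fin 2) ℚ) ^ i *
      MvPolynomial.X 1 ^ (Fintype.card V - i)) fun a ha => by
        rw [(Finset.mem_filter.1 ha).2, Finset.card_univ]]
  rw [Finset.sum_const, nsmul_eq_mul, hexp]
  simp only [map_natCast]
  ring

/-! ### The building set of a complete bipartite graph -/

/-- The graphical building set of `K_{m,n}`. -/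
abbrev bipartiteBuildingSet (m n : ℕ) : Finset (Finset (Fin m ⊕ Fin n)) :=
  graphicalBuildingSet (completeBipartiteGraph (Fin m) (Fin n))

theorem mem_graphicalBuildingSet {V : Type*} [Fintype V] {Γ : SimpleGraph V} {S : Finset V} :
    S ∈ graphicalBuildingSet Γ ↔ (Γ.induce (S : Set V)).Connected := by
  simp [graphicalBuildingSet]

theorem nonempty_of_mem_graphicalBuildingSet {V : Type*} [Fintype V] {Γ : SimpleGraph V}
    {S : Finset V} (hS : S ∈ graphicalBuildingSet Γ) : S.Nonempty := by
  obtain ⟨x⟩ := (mem_graphicalBuildingSet.1 hS).nonempty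
  exact ⟨x.1, x.2⟩

theorem eq_singleton_of_mem_graphicalBuildingSet {V : Type*} [Fintype V] {Γ : SimpleGraph V}
    {S : Finset V} (hS : S ∈ graphicalBuildingSet Γ)
    (h : ∀ x ∈ S, ∀ y ∈ S, ¬ Γ.Adj x y) : ∃ i, S = {i} := by
  obtain ⟨x, hx⟩ := nonempty_of_mem_graphicalBuildingSet hS
  refine ⟨x, Finset.eq_singleton_iff_unique_mem.2 ⟨hx, fun y hy => ?_⟩⟩
  obtain ⟨p⟩ := (mem_graphicalBuildingSet.1 hS).preconnected ⟨y, hy⟩ ⟨x, hx⟩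
  cases p with
  | nil => rfl
  | cons hadj _ => exact absurd hadj (h _ hy _ (Subtype.prop _))

theorem univ_mem_graphicalBuildingSet {V : Type*} [Fintype V] {Γ : SimpleGraph V} :
    Finset.univ ∈ graphicalBuildingSet Γ ↔ Γ.Connected := by
  rw [mem_graphicalBuildingSet, Finset.coe_univ]
  exact (SimpleGraph.induceUnivIso Γ).connected_iff

theorem mem_bipartiteBuildingSet {m n : ℕ} {S : Finset (Fin m ⊕ Fin n)}
    (hl : S.toLeft.Nonempty) (hr : S.toRight.Nonempty) : S ∈ bipartiteBuildingSet m n := by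
  obtain ⟨i, hi⟩ := hl
  obtain ⟨j, hj⟩ := hr
  rw [Finset.mem_toLeft] at hi
  rw [Finset.mem_toRight] at hj
  rw [mem_graphicalBuildingSet]
  set G := (completeBipartiteGraph (Fin m) (Fin n)).induce (S : Set (Fin m ⊕ Fin n)) with hG
  have hlr : ∀ (a : Fin m) (b : Fin n) (ha : Sum.inl a ∈ S) (hb : Sum.inr b ∈ S),
      G.Adj ⟨Sum.inl a, ha⟩ ⟨Sum.inr b, hb⟩ := by
    intro a b ha hb
    simp [hG, completeBipartiteGraph]
  -- Every vertex is joined to the left vertex `i`, if necessary through the right vertex `j`.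
  have hreach : ∀ x : (S : Set (Fin m ⊕ Fin n)), G.Reachable x ⟨Sum.inl i, hi⟩ := by
    rintro ⟨a | b, hx⟩
    · exact (hlr a j hx hj).reachable.trans (hlr i j hi hj).symm.reachable
    · exact (hlr i b hi hx).symm.reachable
  have : Nonempty (S : Set (Fin m ⊕ Fin n)) := ⟨⟨Sum.inl i, hi⟩⟩
  exact SimpleGraph.Connected.mk fun x y => (hreach x).trans (hreach y).symm

theorem eq_singleton_of_mem_bipartiteBuildingSet {m n : ℕ} {S U : Finset (Fin m ⊕ Fin n)}
    (hS : S ∈ bipartiteBuildingSet m n) (hSU : S ⊆ U) (hU : U.toLeft = ∅ ∨ U.toRight = ∅) :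
    ∃ i, S = {i} := by
  refine eq_singleton_of_mem_graphicalBuildingSet hS fun x hx y hy hadj => ?_
  have hl : ∀ i, Sum.inl i ∈ S → U.toLeft ≠ ∅ := fun i hi =>
    Finset.nonempty_iff_ne_empty.1 ⟨i, Finset.mem_toLeft.2 (hSU hi)⟩
  have hr : ∀ i, Sum.inr i ∈ S → U.toRight ≠ ∅ := fun i hi =>
    Finset.nonempty_iff_ne_empty.1 ⟨i, Finset.mem_toRight.2 (hSU hi)⟩
  rcases x with x | x <;> rcases y with y | y
  · simp [completeBipartiteGraph] at hadj
  · exact hU.elim (hl x hx) (hr y hy)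
  · exact hU.elim (hl y hy) (hr x hx)
  · simp [completeBipartiteGraph] at hadj

theorem completeBipartiteGraph_connected_of_pos {m n : ℕ} (hm : 0 < m) (hn : 0 < n) :
    (completeBipartiteGraph (Fin m) (Fin n)).Connected := by
  rw [← univ_mem_graphicalBuildingSet]
  exact mem_bipartiteBuildingSet ⟨⟨0, hm⟩, by simp⟩ ⟨⟨0, hn⟩, by simp⟩

theorem completeBipartiteGraph_connected_iff {m n : ℕ} :
    (completeBipartiteGraph (Fin m) (Fin n)).Connected ↔
      (0 < m ∧ 0 < n) ∨ m + n = 1 := by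
  constructor
  · intro h
    by_contra hmn
    push Not at hmn
    have h0 : m = 0 ∨ n = 0 := by
      by_contra h0
      omega
    obtain ⟨i, hi⟩ := eq_singleton_of_mem_bipartiteBuildingSet
      (univ_mem_graphicalBuildingSet.2 h) (Finset.subset_univ _) (by
        rcases h0 with rfl | rfl
        · left; exact Finset.eq_empty_of_isEmpty _
        · right; exact Finset.eq_empty_of_isEmpty _)
    have := congrArg Finset.card hi
    simp at this
    exact hmn.2 this
  · rintro (⟨hm, hn⟩ | h)
    · exact completeBipartiteGraph_connected_of_pos hm hn
    · have : Subsingleton (Fin m ⊕ Fin n) :=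
        Fintype.card_le_one_iff_subsingleton.1 (by simp [h])
      have : Nonempty (Fin m ⊕ Fin n) := Fintype.card_pos_iff.1 (by simp [h])
      exact SimpleGraph.Connected.mk fun x y => by rw [Subsingleton.elim x y]

theorem sum_powerset_card_toLeft_toRight {α β R : Type*} [DecidableEq α] [DecidableEq β]
    [CommSemiring R] (U : Finset (α ⊕ β)) (g : ℕ → ℕ → R) :
    ∑ M ∈ U.powerset, g M.toLeft.card M.toRight.card =
      ∑ i ∈ Finset.range (U.toLeft.card + 1), ∑ j ∈ Finset.range (U.toRight.card + 1),
        (U.toLeft.card.choose i * U.toRight.card.choose j : ℕ) * g i j := by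
  have h1 : ∑ M ∈ U.powerset, g M.toLeft.card M.toRight.card =
      ∑ p ∈ U.toLeft.powerset ×ˢ U.toRight.powerset, g p.1.card p.2.card := by
    refine Finset.sum_bij' (fun M _ => (M.toLeft, M.toRight)) (fun p _ => p.1.disjSum p.2)
      ?_ ?_ ?_ ?_ ?_
    · intro M hM
      rw [Finset.mem_powerset] at hM
      exact Finset.mem_product.2 ⟨Finset.mem_powerset.2 (Finset.toLeft_subset_toLeft hM),
        Finset.mem_powerset.2 (Finset.toRight_subset_toRight hM)⟩
    · intro p hp
      rw [Finset.mem_product, Finset.mem_powerset, Finset.mem_powerset] at hp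
      rw [Finset.mem_powerset, ← Finset.toLeft_disjSum_toRight (u := U)]
      exact Finset.disjSum_mono hp.1 hp.2
    · intro M _
      exact Finset.toLeft_disjSum_toRight
    · intro p _
      simp
    · intro M _
      rfl
  rw [h1, Finset.sum_product,
    Finset.sum_powerset_apply_card fun i => ∑ C ∈ U.toRight.powerset, g i C.card]
  refine Finset.sum_congr rfl fun i _ => ?_
  rw [Finset.sum_powerset_apply_card, nsmul_eq_mul, Finset.mul_sum]
  refine Finset.sum_congr rfl fun j _ => ?_
  rw [nsmul_eq_mul]
  push_cast
  ring

/-- The face enumerators of the restrictions of `B(K_{m,n})` depend only on the sizes of the two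
sides, and are determined by the recursion over the top level set of a face. -/
theorem faceEnumerator_bipartite {R : Type*} [CommRing R] [IsDomain R] {u v : R} (hu : u ≠ 0)
    (c : ℕ → ℕ → R) (hl : ∀ a, c a 0 = v ^ a) (hr : ∀ b, c 0 b = v ^ b)
    (hc : ∀ a b, 0 < a → 0 < b → (u + v) * c a b =
      v * ∑ i ∈ Finset.range (a + 1), ∑ j ∈ Finset.range (b + 1),
        (a.choose i * b.choose j : ℕ) * (u ^ (i + j) * c (a - i) (b - j)))
    {m n : ℕ} (U : Finset (Fin m ⊕ Fin n)) :
    faceEnumerator u v (bipartiteBuildingSet m n) U = c U.toLeft.card U.toRight.card := by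
  induction U using Finset.strongInduction with
  | H U ih =>
  have hcard : U.toLeft.card + U.toRight.card = U.card := Finset.card_toLeft_add_card_toRight
  rcases U.toLeft.eq_empty_or_nonempty with h | h1
  · rw [faceEnumerator_of_forall_singleton u v fun S hS hSU =>
      eq_singleton_of_mem_bipartiteBuildingSet hS hSU (Or.inl h), ← hcard, h]
    simp [hr]
  rcases U.toRight.eq_empty_or_nonempty with h | h2
  · rw [faceEnumerator_of_forall_singleton u v fun S hS hSU =>
      eq_singleton_of_mem_bipartiteBuildingSet hS hSU (Or.inr h), ← hcard, h]
    simp [hl]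
  have hU := mem_bipartiteBuildingSet h1 h2
  have hne : U.Nonempty := nonempty_of_mem_graphicalBuildingSet hU
  have hcU := hc _ _ h1.card_pos h2.card_pos
  rw [← sum_powerset_card_toLeft_toRight U fun i j =>
    u ^ (i + j) * c (U.toLeft.card - i) (U.toRight.card - j)] at hcU
  apply mul_left_cancel₀ hu
  rw [← Finset.sum_filter_add_sum_filter_not U.powerset (fun M => M.Nonempty)] at hcU
  have hempty : U.powerset.filter (fun M => ¬ M.Nonempty) = {∅} := by
    ext M
    simp only [Finset.mem_filter, Finset.mem_powerset, Finset.not_nonempty_iff_eq_empty,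
      Finset.mem_singleton]
    constructor
    · exact fun h => h.2
    · rintro rfl
      simp
  rw [hempty, Finset.sum_singleton] at hcU
  have hl0 : (∅ : Finset (Fin m ⊕ Fin n)).toLeft = ∅ := by ext x; simp
  have hr0 : (∅ : Finset (Fin m ⊕ Fin n)).toRight = ∅ := by ext x; simp
  simp only [hl0, hr0, Finset.card_empty, add_zero, pow_zero,
    one_mul, Nat.sub_zero] at hcU
  have hcU' : u * c U.toLeft.card U.toRight.card = v * ∑ M ∈ U.powerset with M.Nonempty,
      u ^ (M.toLeft.card + M.toRight.card) *
        c (U.toLeft.card - M.toLeft.card) (U.toRight.card - M.toRight.card) := by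
    linear_combination hcU
  rw [hcU', faceEnumerator_eq_sum u v hU hne, Finset.mul_sum, Finset.mul_sum]
  refine Finset.sum_congr rfl fun M hM => ?_
  rw [Finset.mem_filter, Finset.mem_powerset] at hM
  rw [ih _ (Finset.sdiff_ssubset hM.1 hM.2), Finset.card_toLeft_add_card_toRight,
    Finset.toLeft_sdiff, Finset.toRight_sdiff,
    Finset.card_sdiff_of_subset (Finset.toLeft_subset_toLeft hM.1),
    Finset.card_sdiff_of_subset (Finset.toRight_subset_toRight hM.1)]
  obtain ⟨k, hk⟩ : ∃ k, M.card = k + 1 := ⟨M.card - 1, by have := hM.2.card_pos; omega⟩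
  rw [hk, Nat.add_sub_cancel]
  ring

/-! ### Power series with coefficients in a subsemiring -/

open PowerSeries in
/-- The power series with all coefficients in `N`. -/
def coeffSubsemiring {R : Type*} [CommSemiring R] (N : Subsemiring R) :
    Subsemiring (PowerSeries R) where
  carrier := {f | ∀ n, coeff n f ∈ N}
  mul_mem' := by
    intro f g hf hg n
    rw [coeff_mul]
    exact N.sum_mem fun p _ => N.mul_mem (hf p.1) (hg p.2)
  one_mem' := by
    intro n
    rw [coeff_one]
    split_ifs
    · exact N.one_mem
    · exact N.zero_mem
  add_mem' := by
    intro f g hf hg n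
    rw [map_add]
    exact N.add_mem (hf n) (hg n)
  zero_mem' := fun n => by simp

theorem C_mem_coeffSubsemiring {R : Type*} [CommSemiring R] {N : Subsemiring R} {r : R}
    (hr : r ∈ N) : PowerSeries.C r ∈ coeffSubsemiring N := by
  intro n
  rw [PowerSeries.coeff_C]
  split_ifs
  · exact hr
  · exact N.zero_mem

theorem X_mem_coeffSubsemiring {R : Type*} [CommSemiring R] {N : Subsemiring R} :
    (PowerSeries.X : PowerSeries R) ∈ coeffSubsemiring N := by
  intro n
  rw [PowerSeries.coeff_X]
  split_ifs
  · exact N.one_mem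
  · exact N.zero_mem

theorem map_C_mem_coeffSubsemiring {R : Type*} [CommSemiring R] {N : Subsemiring R}
    {f : PowerSeries R} (hf : f ∈ coeffSubsemiring N) :
    PowerSeries.map PowerSeries.C f ∈ coeffSubsemiring (coeffSubsemiring N) := by
  intro n
  rw [PowerSeries.coeff_map]
  exact C_mem_coeffSubsemiring (hf n)

/-- If `f` and `K` have coefficients in `N` and `K` has no constant term, then the
solution of `H = f + K * H` has coefficients in `N`: it is `f` times the geometric series of `K`. -/
theorem mem_coeffSubsemiring_of_eq_add_mul {R : Type*} [CommSemiring R] {N : Subsemiring R}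
    {f K H : PowerSeries R} (hf : f ∈ coeffSubsemiring N) (hK : K ∈ coeffSubsemiring N)
    (hK0 : PowerSeries.constantCoeff K = 0) (hH : H = f + K * H) : H ∈ coeffSubsemiring N := by
  intro n
  induction n using Nat.strong_induction_on with
  | _ n ih =>
  rw [hH, map_add, PowerSeries.coeff_mul]
  refine N.add_mem (hf n) (N.sum_mem fun p hp => ?_)
  rw [Finset.HasAntidiagonal.mem_antidiagonal] at hp
  rcases Nat.eq_zero_or_pos p.1 with h | h
  · rw [h, PowerSeries.coeff_zero_eq_constantCoeff_apply, hK0, zero_mul]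
    exact N.zero_mem
  · exact N.mul_mem (hK _) (ih _ (by omega))

/-! ### Linear and Riccati differential equations -/

open PowerSeries in
/-- The coefficients of the solution of `Y' = q₀ + q₁ Y + q₂ Y²` without constant term. -/
def riccatiCoeff {R : Type*} [CommRing R] [Algebra ℚ R] (q₀ q₁ q₂ : PowerSeries R) : ℕ → R
  | 0 => 0
  | n + 1 => algebraMap ℚ R (1 / (n + 1)) * coeff n (q₀ +
      q₁ * mk (fun k => if _h : k < n + 1 then riccatiCoeff q₀ q₁ q₂ k else 0) +
      q₂ * (mk (fun k => if _h : k < n + 1 then riccatiCoeff q₀ q₁ q₂ k else 0) *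
        mk (fun k => if _h : k < n + 1 then riccatiCoeff q₀ q₁ q₂ k else 0)))

theorem coeff_mul_congr {R : Type*} [CommSemiring R] {f f' g g' : PowerSeries R} {n : ℕ}
    (hf : ∀ k ≤ n, PowerSeries.coeff k f = PowerSeries.coeff k f')
    (hg : ∀ k ≤ n, PowerSeries.coeff k g = PowerSeries.coeff k g') :
    PowerSeries.coeff n (f * g) = PowerSeries.coeff n (f' * g') := by
  rw [PowerSeries.coeff_mul, PowerSeries.coeff_mul]
  refine Finset.sum_congr rfl fun p hp => ?_
  rw [Finset.HasAntidiagonal.mem_antidiagonal] at hp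
  rw [hf p.1 (by omega), hg p.2 (by omega)]

open PowerSeries in
/-- A Riccati equation has a solution without constant term, and its coefficients can be computed
from those of the equation by additions, multiplications and divisions by positive integers. -/
theorem exists_riccati {R : Type*} [CommRing R] [Algebra ℚ R] {N : Subsemiring R}
    (hN : ∀ n : ℕ, algebraMap ℚ R (1 / (n + 1)) ∈ N) {q₀ q₁ q₂ : PowerSeries R}
    (h₀ : q₀ ∈ coeffSubsemiring N) (h₁ : q₁ ∈ coeffSubsemiring N)
    (h₂ : q₂ ∈ coeffSubsemiring N) :
    ∃ Y ∈ coeffSubsemiring N, constantCoeff Y = 0 ∧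
      derivative R Y = q₀ + q₁ * Y + q₂ * (Y * Y) := by
  refine ⟨mk (riccatiCoeff q₀ q₁ q₂), ?_, ?_, ?_⟩
  · intro n
    rw [coeff_mk]
    induction n using Nat.strong_induction_on with
    | _ n ih =>
    cases n with
    | zero => rw [riccatiCoeff]; exact N.zero_mem
    | succ n =>
      rw [riccatiCoeff]
      have hY : mk (fun k => if _h : k < n + 1 then riccatiCoeff q₀ q₁ q₂ k else 0) ∈
          coeffSubsemiring N := by
        intro k
        rw [coeff_mk]
        split_ifs with h
        · exact ih k h
        · exact N.zero_mem
      exact N.mul_mem (hN n) ((add_mem (add_mem h₀ (mul_mem h₁ hY))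
        (mul_mem h₂ (mul_mem hY hY)) : _ ∈ coeffSubsemiring N) n)
  · rw [← coeff_zero_eq_constantCoeff_apply, coeff_mk, riccatiCoeff]
  · ext n
    rw [coeff_derivative, coeff_mk, riccatiCoeff]
    have hcancel : algebraMap ℚ R (1 / (n + 1)) * ((n : R) + 1) = 1 := by
      have h1 : ((n : R) + 1) = algebraMap ℚ R (n + 1) := by simp
      rw [h1, ← map_mul, one_div, inv_mul_cancel₀ (by positivity), map_one]
    have hY : ∀ k ≤ n, coeff k (mk (fun k => if _h : k < n + 1 then
        riccatiCoeff q₀ q₁ q₂ k else 0)) = coeff k (mk (riccatiCoeff q₀ q₁ q₂)) := by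
      intro k hk
      rw [coeff_mk, coeff_mk, dif_pos (Nat.lt_succ_of_le hk)]
    have hYY : ∀ k ≤ n, coeff k (mk (fun k => if _h : k < n + 1 then
        riccatiCoeff q₀ q₁ q₂ k else 0) * mk (fun k => if _h : k < n + 1 then
        riccatiCoeff q₀ q₁ q₂ k else 0)) =
        coeff k (mk (riccatiCoeff q₀ q₁ q₂) * mk (riccatiCoeff q₀ q₁ q₂)) := fun k hk =>
      coeff_mul_congr (fun i hi => hY i (hi.trans hk)) fun i hi => hY i (hi.trans hk)
    rw [map_add, map_add, map_add, map_add, coeff_mul_congr (fun _ _ => rfl) hY,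
      coeff_mul_congr (fun _ _ => rfl) hYY]
    linear_combination (coeff n q₀ + coeff n (q₁ * mk (riccatiCoeff q₀ q₁ q₂)) +
      coeff n (q₂ * (mk (riccatiCoeff q₀ q₁ q₂) * mk (riccatiCoeff q₀ q₁ q₂)))) * hcancel

open PowerSeries in
theorem eq_zero_of_derivative_eq_mul {R : Type*} [CommRing R] [Algebra ℚ R]
    {c Z : PowerSeries R} (h0 : constantCoeff Z = 0) (hZ : derivative R Z = c * Z) : Z = 0 := by
  ext n
  rw [map_zero]
  induction n using Nat.strong_induction_on with
  | _ n ih =>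
  cases n with
  | zero => rw [coeff_zero_eq_constantCoeff_apply, h0]
  | succ n =>
    have h1 := congrArg (coeff n) hZ
    rw [coeff_derivative, coeff_mul, Finset.sum_eq_zero] at h1
    · have h2 : ((n : R) + 1) * algebraMap ℚ R (1 / (n + 1)) = 1 := by
        have h3 : ((n : R) + 1) = algebraMap ℚ R (n + 1) := by simp
        rw [h3, ← map_mul, one_div, mul_inv_cancel₀ (by positivity), map_one]
      linear_combination (algebraMap ℚ R (1 / (n + 1))) * h1 - coeff (n + 1) Z * h2
    · intro p hp
      rw [Finset.HasAntidiagonal.mem_antidiagonal] at hp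
      rw [ih p.2 (by omega), mul_zero]

/-! ### The Eulerian series -/

/-- The series `e^{r x}`. -/
def expSeries {R : Type*} [CommRing R] [Algebra ℚ R] (r : R) : PowerSeries R :=
  PowerSeries.mk fun n => algebraMap ℚ R (1 / n.factorial) * r ^ n

theorem derivative_expSeries {R : Type*} [CommRing R] [Algebra ℚ R] (r : R) :
    PowerSeries.derivative R (expSeries r) = PowerSeries.C r * expSeries r := by
  ext n
  rw [PowerSeries.coeff_derivative, PowerSeries.coeff_C_mul, expSeries, PowerSeries.coeff_mk,
    PowerSeries.coeff_mk]
  have h1 : ((n : R) + 1) = algebraMap ℚ R (n + 1) := by simp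
  have h2 : algebraMap ℚ R (1 / (n + 1).factorial) * algebraMap ℚ R (n + 1) =
      algebraMap ℚ R (1 / n.factorial) := by
    rw [← map_mul]
    congr 1
    rw [Nat.factorial_succ]
    push_cast
    field_simp
  rw [h1]
  linear_combination r ^ (n + 1) * h2

theorem constantCoeff_expSeries {R : Type*} [CommRing R] [Algebra ℚ R] (r : R) :
    PowerSeries.constantCoeff (expSeries r) = 1 := by
  rw [← PowerSeries.coeff_zero_eq_constantCoeff_apply, expSeries, PowerSeries.coeff_mk]
  simp

theorem expSeries_mul {R : Type*} [CommRing R] [Algebra ℚ R] (r q : R) :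
    expSeries r * expSeries q = expSeries (r + q) := by
  rw [← sub_eq_zero]
  apply eq_zero_of_derivative_eq_mul (c := PowerSeries.C (r + q))
  · simp [constantCoeff_expSeries]
  · simp only [map_sub, Derivation.leibniz, derivative_expSeries, smul_eq_mul, map_add]
    ring

/-- The denominator `α e^{t x} - t e^{α x}` of the Eulerian series. -/
def eulerDenominator {R : Type*} [CommRing R] [Algebra ℚ R] (α t : R) : PowerSeries R :=
  PowerSeries.C α * expSeries t - PowerSeries.C t * expSeries α

theorem derivative_eulerDenominator {R : Type*} [CommRing R] [Algebra ℚ R] (α t : R) :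
    PowerSeries.derivative R (eulerDenominator α t) =
      -(PowerSeries.C (α * t) * (expSeries α - expSeries t)) := by
  simp only [eulerDenominator, map_sub, Derivation.leibniz, derivative_expSeries, smul_eq_mul,
    PowerSeries.derivative_C, map_mul]
  ring

/-- The solution of `E' = 1 + (α + t) E + α t E²` without constant term, the exponential
generating series of the `h`-polynomials of permutohedra, is
`(e^{α x} - e^{t x}) / (α e^{t x} - t e^{α x})`. -/
theorem mul_eulerDenominator_eq {R : Type*} [CommRing R] [Algebra ℚ R] {α t : R}
    {E : PowerSeries R} (hE0 : PowerSeries.constantCoeff E = 0)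
    (hE : PowerSeries.derivative R E =
      1 + PowerSeries.C (α + t) * E + PowerSeries.C (α * t) * (E * E)) :
    E * eulerDenominator α t = expSeries α - expSeries t := by
  rw [← sub_eq_zero]
  apply eq_zero_of_derivative_eq_mul (c := PowerSeries.C (α + t) + PowerSeries.C (α * t) * E)
  · simp [hE0, constantCoeff_expSeries]
  · simp only [map_sub, Derivation.leibniz, derivative_expSeries, smul_eq_mul, hE,
      derivative_eulerDenominator]
    simp only [eulerDenominator, map_add, map_mul]
    ring

/-- The solution of `T' = ((α + t) + α t E) T + α t E` without constant term is
`(α - t) e^{(α + t) x} / (α e^{t x} - t e^{α x}) - 1 - (α + t) E`. -/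
theorem add_mul_eulerDenominator_eq {R : Type*} [CommRing R] [Algebra ℚ R] {α t : R}
    {E T : PowerSeries R} (hE0 : PowerSeries.constantCoeff E = 0)
    (hE : PowerSeries.derivative R E =
      1 + PowerSeries.C (α + t) * E + PowerSeries.C (α * t) * (E * E))
    (hT0 : PowerSeries.constantCoeff T = 0)
    (hT : PowerSeries.derivative R T = PowerSeries.C (α * t) * E +
      (PowerSeries.C (α + t) + PowerSeries.C (α * t) * E) * T) :
    (T + 1 + PowerSeries.C (α + t) * E) * eulerDenominator α t =
      PowerSeries.C (α - t) * (expSeries α * expSeries t) := by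
  have hED := mul_eulerDenominator_eq hE0 hE
  rw [← sub_eq_zero]
  apply eq_zero_of_derivative_eq_mul (c := PowerSeries.C (α + t))
  · simp [hE0, hT0, constantCoeff_expSeries, eulerDenominator]
  · simp only [map_sub, map_add, Derivation.leibniz, derivative_expSeries, smul_eq_mul, hE, hT,
      PowerSeries.derivative_C, derivative_eulerDenominator, map_mul, Derivation.map_one_eq_zero]
    linear_combination (PowerSeries.C α * PowerSeries.C t) *
      (T + 1 + (PowerSeries.C α + PowerSeries.C t) * E) * hED

/-! ### The generating series of the `h`-polynomials -/

/-- A series in `x`, seen in `R[[x]][[y]]`. -/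
abbrev inX {R : Type*} [CommRing R] : PowerSeries R →+* PowerSeries (PowerSeries R) :=
  PowerSeries.C

/-- A series with its variable renamed to `y`, seen in `R[[x]][[y]]`. -/
abbrev inY {R : Type*} [CommRing R] : PowerSeries R →+* PowerSeries (PowerSeries R) :=
  PowerSeries.map PowerSeries.C

/-- A constant, seen in `R[[x]][[y]]`. -/
abbrev inXY {R : Type*} [CommRing R] : R →+* PowerSeries (PowerSeries R) :=
  PowerSeries.C.comp PowerSeries.C

/-- The coefficient of `x ^ m * y ^ n`. -/
abbrev biCoeff {R : Type*} [CommRing R] (m n : ℕ) (F : PowerSeries (PowerSeries R)) : R :=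
  PowerSeries.coeff m (PowerSeries.coeff n F)

theorem inY_C {R : Type*} [CommRing R] (r : R) : inY (PowerSeries.C r) = inXY r := by
  simp

theorem biCoeff_inX_mul_inY_mul {R : Type*} [CommRing R] (f g : PowerSeries R)
    (F : PowerSeries (PowerSeries R)) (m n : ℕ) :
    biCoeff m n (inX f * inY g * F) = ∑ i ∈ Finset.range (m + 1), ∑ j ∈ Finset.range (n + 1),
      PowerSeries.coeff i f * PowerSeries.coeff j g * biCoeff (m - i) (n - j) F := by
  have h1 : PowerSeries.coeff n (inX f * inY g * F) = ∑ j ∈ Finset.range (n + 1),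
      PowerSeries.C (PowerSeries.coeff j g) * (f * PowerSeries.coeff (n - j) F) := by
    rw [mul_assoc, PowerSeries.coeff_C_mul, PowerSeries.coeff_mul,
      Finset.Nat.sum_antidiagonal_eq_sum_range_succ_mk, Finset.mul_sum]
    refine Finset.sum_congr rfl fun j _ => ?_
    rw [PowerSeries.coeff_map]
    ring
  rw [biCoeff, h1, map_sum, Finset.sum_comm]
  refine Finset.sum_congr rfl fun j _ => ?_
  rw [PowerSeries.coeff_C_mul, PowerSeries.coeff_mul,
    Finset.Nat.sum_antidiagonal_eq_sum_range_succ_mk, Finset.mul_sum]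
  refine Finset.sum_congr rfl fun i _ => ?_
  ring

/-- The series of face enumerators for `u = α - t` and `v = t` is
`t H + e^{t x} + e^{t y} - 1`, the exponentials coming from vertex sets in one side. Its defining
equation expresses the recursion over the top level set of a face, which contributes the factor
`e^{(α - t) (x + y)}`. -/
theorem mul_sub_eq_of_mul_one_sub_eq {R : Type*} [CommRing R] [IsDomain R] [Algebra ℚ R]
    {α t : R} (hαt : α - t ≠ 0) {E T : PowerSeries R}
    (hE0 : PowerSeries.constantCoeff E = 0)
    (hE : PowerSeries.derivative R E =
      1 + PowerSeries.C (α + t) * E + PowerSeries.C (α * t) * (E * E))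
    (hT0 : PowerSeries.constantCoeff T = 0)
    (hT : PowerSeries.derivative R T = PowerSeries.C (α * t) * E +
      (PowerSeries.C (α + t) + PowerSeries.C (α * t) * E) * T)
    {H : PowerSeries (PowerSeries R)}
    (hH : H * (1 - inXY (α * t) * (inX E * inY E)) =
      inX T * inY E + inX E * inY T + inXY (α + t) * (inX E * inY E)) :
    (inXY t * H + inX (expSeries t) + inY (expSeries t) - 1) *
        (inXY α - inXY t * (inX (expSeries (α - t)) * inY (expSeries (α - t)))) =
      inX (eulerDenominator α t) + inY (eulerDenominator α t) - inXY (α - t) := by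
  have hED := mul_eulerDenominator_eq hE0 hE
  have hTD := add_mul_eulerDenominator_eq hE0 hE hT0 hT
  have hA : expSeries t * expSeries (α - t) = expSeries α := by
    rw [expSeries_mul]
    congr 1
    ring
  have hne : expSeries t ≠ 0 := fun h => by
    have := constantCoeff_expSeries t
    rw [h, map_zero] at this
    exact zero_ne_one this
  have hc : inXY (α - t) * (inX (expSeries t) * inY (expSeries t)) ≠ 0 := by
    refine mul_ne_zero ?_ (mul_ne_zero ?_ ?_)
    · exact (map_ne_zero_iff inXY (PowerSeries.C_injective.comp PowerSeries.C_injective)).2 hαt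
    · exact (map_ne_zero_iff inX PowerSeries.C_injective).2 hne
    · exact (map_ne_zero_iff inY (PowerSeries.map_injective _ PowerSeries.C_injective)).2 hne
  have hAx := congrArg inX hA
  have hAy := congrArg inY hA
  have hEx := congrArg inX hED
  have hEy := congrArg inY hED
  have hTx := congrArg inX hTD
  have hTy := congrArg inY hTD
  have hDx : inX (eulerDenominator α t) =
      inXY α * inX (expSeries t) - inXY t * inX (expSeries α) := by
    simp [eulerDenominator]
  have hDy : inY (eulerDenominator α t) =
      inXY α * inY (expSeries t) - inXY t * inY (expSeries α) := by
    rw [eulerDenominator, map_sub, map_mul, map_mul, inY_C, inY_C]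
  have hCx : ∀ r : R, inX (PowerSeries.C r) = inXY r := fun r => rfl
  simp only [map_mul, map_sub, map_add, map_one, inY_C, hCx] at hAx hAy hEx hEy hTx hTy hH
  apply mul_left_cancel₀ hc
  simp only [map_sub]
  generalize inXY α = a' at *
  generalize inXY t = t' at *
  generalize inX (eulerDenominator α t) = Dx at *
  generalize inY (eulerDenominator α t) = Dy at *
  generalize inX (expSeries (α - t)) = Xx at *
  generalize inY (expSeries (α - t)) = Yy at *
  generalize inX (expSeries t) = ax at *
  generalize inY (expSeries t) = ay at *
  generalize inX (expSeries α) = Ax at *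
  generalize inY (expSeries α) = Ay at *
  generalize inX E = Ex at *
  generalize inY E = Ey at *
  generalize inX T = Tx at *
  generalize inY T = Ty at *
  -- The two products of the Eulerian series with its denominator clear all fractions.
  have h1 : (1 - a' * t' * (Ex * Ey)) * (Dx * Dy) = (a' - t') * (a' * ax * ay - t' * Ax * Ay) := by
    have : (Ex * Dx) * (Ey * Dy) = (Ax - ax) * (Ay - ay) := by rw [hEx, hEy]
    linear_combination -(a' * t') * this + Dy * hDx + (a' * ax - t' * Ax) * hDy
  have h2 : (Tx * Ey + Ex * Ty + (a' + t') * (Ex * Ey)) * (Dx * Dy) =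
      (a' - t') * (Ax * ax) * (Ay - ay) + (a' - t') * (Ay * ay) * (Ax - ax)
        - Dx * (Ay - ay) - Dy * (Ax - ax) - (a' + t') * ((Ax - ax) * (Ay - ay)) := by
    have e1 : Tx * Dx = (a' - t') * (Ax * ax) - Dx - (a' + t') * (Ax - ax) := by
      linear_combination hTx - (a' + t') * hEx
    have e2 : Ty * Dy = (a' - t') * (Ay * ay) - Dy - (a' + t') * (Ay - ay) := by
      linear_combination hTy - (a' + t') * hEy
    calc _ = (Tx * Dx) * (Ey * Dy) + (Ex * Dx) * (Ty * Dy)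
          + (a' + t') * ((Ex * Dx) * (Ey * Dy)) := by ring
      _ = _ := by rw [e1, e2, hEx, hEy]; ring
  have h3 : H * ((a' - t') * (a' * ax * ay - t' * Ax * Ay)) =
      (a' - t') * (Ax * ax) * (Ay - ay) + (a' - t') * (Ay * ay) * (Ax - ax)
        - Dx * (Ay - ay) - Dy * (Ax - ax) - (a' + t') * ((Ax - ax) * (Ay - ay)) := by
    rw [← h1, ← h2, ← hH]
    ring
  have h4 : ax * ay * (a' - t' * (Xx * Yy)) = a' * ax * ay - t' * Ax * Ay := by
    rw [← hAx, ← hAy]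
    ring
  calc _ = (a' - t') * (t' * H + ax + ay - 1) * (ax * ay * (a' - t' * (Xx * Yy))) := by ring
    _ = (a' - t') * (t' * H + ax + ay - 1) * (a' * ax * ay - t' * Ax * Ay) := by rw [h4]
    _ = _ := by
      rw [hDx, hDy] at *
      linear_combination t' * h3

theorem choose_mul_factorial_cast {R : Type*} [CommRing R] [Algebra ℚ R] {a i : ℕ}
    (hi : i ≤ a) :
    (a.choose i : R) * ((a - i).factorial : R) =
      (a.factorial : R) * algebraMap ℚ R (1 / i.factorial) := by
  have h1 : (a.choose i : ℚ) * ((a - i).factorial : ℚ) =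
      (a.factorial : ℚ) * (1 / i.factorial) := by
    rw [← Nat.choose_mul_factorial_mul_factorial hi]
    push_cast
    field_simp
  have h2 := congrArg (algebraMap ℚ R) h1
  simpa using h2

theorem factorial_mul_algebraMap_one_div {R : Type*} [CommRing R] [Algebra ℚ R] (a : ℕ) :
    (a.factorial : R) * algebraMap ℚ R (1 / a.factorial) = 1 := by
  have h : (a.factorial : R) = algebraMap ℚ R a.factorial := by simp
  rw [h, ← map_mul, mul_one_div_cancel (by positivity), map_one]

theorem biCoeff_inXY_mul {R : Type*} [CommRing R] (r : R) (F : PowerSeries (PowerSeries R))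
    (m n : ℕ) : biCoeff m n (inXY r * F) = r * biCoeff m n F := by
  simp only [inXY, RingHom.comp_apply, biCoeff, PowerSeries.coeff_C_mul]

theorem biCoeff_inX {R : Type*} [CommRing R] (f : PowerSeries R) (m n : ℕ) :
    biCoeff m n (inX f) = if n = 0 then PowerSeries.coeff m f else 0 := by
  simp only [biCoeff, inX, PowerSeries.coeff_C]
  split_ifs <;> simp

theorem biCoeff_inY {R : Type*} [CommRing R] (f : PowerSeries R) (m n : ℕ) :
    biCoeff m n (inY f) = if m = 0 then PowerSeries.coeff n f else 0 := by
  simp only [biCoeff, inY, PowerSeries.coeff_map, PowerSeries.coeff_C]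

/-- The face enumerators of `K_{m,n}`, read off from a series `H` with
`H (1 - α t E(x) E(y)) = T(x) E(y) + E(x) T(y) + (α + t) E(x) E(y)`. -/
theorem faceEnumerator_eq_biCoeff {R : Type*} [CommRing R] [IsDomain R] [Algebra ℚ R]
    {α t : R} (hαt : α - t ≠ 0) {E T : PowerSeries R}
    (hE0 : PowerSeries.constantCoeff E = 0)
    (hE : PowerSeries.derivative R E =
      1 + PowerSeries.C (α + t) * E + PowerSeries.C (α * t) * (E * E))
    (hT0 : PowerSeries.constantCoeff T = 0)
    (hT : PowerSeries.derivative R T = PowerSeries.C (α * t) * E +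
      (PowerSeries.C (α + t) + PowerSeries.C (α * t) * E) * T)
    {H : PowerSeries (PowerSeries R)}
    (hH0 : ∀ m n, m = 0 ∨ n = 0 → biCoeff m n H = 0)
    (hH : H * (1 - inXY (α * t) * (inX E * inY E)) =
      inX T * inY E + inX E * inY T + inXY (α + t) * (inX E * inY E))
    {m n : ℕ} (U : Finset (Fin m ⊕ Fin n)) :
    faceEnumerator (α - t) t (bipartiteBuildingSet m n) U =
      U.toLeft.card.factorial * U.toRight.card.factorial *
        biCoeff U.toLeft.card U.toRight.card
          (inXY t * H + inX (expSeries t) + inY (expSeries t) - 1) := by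
  set Φ := inXY t * H + inX (expSeries t) + inY (expSeries t) - 1 with hΦ
  have hcoeff : ∀ a, PowerSeries.coeff a (expSeries t) =
      algebraMap ℚ R (1 / a.factorial) * t ^ a := fun a => by
    rw [expSeries, PowerSeries.coeff_mk]
  have hone : ∀ a b, biCoeff a b (1 : PowerSeries (PowerSeries R)) =
      if b = 0 then PowerSeries.coeff a 1 else 0 := fun a b => by
    rw [← map_one inX, biCoeff_inX]
  have hΦc : ∀ a b, biCoeff a b Φ = t * biCoeff a b H + biCoeff a b (inX (expSeries t)) +
      biCoeff a b (inY (expSeries t)) - biCoeff a b 1 := by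
    intro a b
    rw [← biCoeff_inXY_mul, hΦ]
    simp only [biCoeff, map_add, map_sub]
  refine faceEnumerator_bipartite hαt
    (fun a b => (a.factorial : R) * b.factorial * biCoeff a b Φ) ?_ ?_ ?_ U
  · intro a
    simp only [hΦc, hH0 a 0 (Or.inr rfl), biCoeff_inX, biCoeff_inY, hone, hcoeff, if_true,
      PowerSeries.coeff_one]
    have := factorial_mul_algebraMap_one_div (R := R) a
    split_ifs with h
    · subst h; simp
    · simp only [Nat.factorial_zero, Nat.cast_one]
      linear_combination t ^ a * this
  · intro b
    simp only [hΦc, hH0 0 b (Or.inl rfl), biCoeff_inX, biCoeff_inY, hone, hcoeff, if_true,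
      PowerSeries.coeff_one]
    have := factorial_mul_algebraMap_one_div (R := R) b
    split_ifs with h
    · subst h; simp
    · simp only [Nat.factorial_zero, Nat.cast_one]
      linear_combination t ^ b * this
  · intro a b ha hb
    have hmain := mul_sub_eq_of_mul_one_sub_eq hαt hE0 hE hT0 hT hH
    rw [← hΦ] at hmain
    have h1 : inXY α * Φ = inXY t * (inX (expSeries (α - t)) * inY (expSeries (α - t)) * Φ) +
        inX (eulerDenominator α t) + inY (eulerDenominator α t) - inX (PowerSeries.C (α - t)) := by
      have : inX (PowerSeries.C (α - t)) = inXY (α - t) := rfl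
      rw [this]
      linear_combination hmain
    have h2 : biCoeff a b (inXY α * Φ) =
        biCoeff a b (inXY t * (inX (expSeries (α - t)) * inY (expSeries (α - t)) * Φ)) +
        biCoeff a b (inX (eulerDenominator α t)) + biCoeff a b (inY (eulerDenominator α t)) -
        biCoeff a b (inX (PowerSeries.C (α - t))) := by
      rw [h1]
      simp only [biCoeff, map_add, map_sub]
    rw [biCoeff_inXY_mul, biCoeff_inXY_mul, biCoeff_inX, biCoeff_inX, biCoeff_inY,
      biCoeff_inX_mul_inY_mul, if_neg ha.ne', if_neg hb.ne', if_neg hb.ne'] at h2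
    have h3 : ∑ i ∈ Finset.range (a + 1), ∑ j ∈ Finset.range (b + 1),
        (a.choose i * b.choose j : ℕ) * ((α - t) ^ (i + j) *
          (((a - i).factorial : R) * (b - j).factorial * biCoeff (a - i) (b - j) Φ)) =
        (a.factorial : R) * b.factorial * ∑ i ∈ Finset.range (a + 1),
          ∑ j ∈ Finset.range (b + 1), PowerSeries.coeff i (expSeries (α - t)) *
            PowerSeries.coeff j (expSeries (α - t)) * biCoeff (a - i) (b - j) Φ := by
      rw [Finset.mul_sum]
      refine Finset.sum_congr rfl fun i hi => ?_
      rw [Finset.mul_sum]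
      refine Finset.sum_congr rfl fun j hj => ?_
      have hi' := choose_mul_factorial_cast (R := R) (Nat.lt_succ_iff.1 (Finset.mem_range.1 hi))
      have hj' := choose_mul_factorial_cast (R := R) (Nat.lt_succ_iff.1 (Finset.mem_range.1 hj))
      rw [expSeries, PowerSeries.coeff_mk, PowerSeries.coeff_mk]
      push_cast
      calc _ = ((a.choose i : R) * (a - i).factorial) * ((b.choose j : R) * (b - j).factorial) *
            ((α - t) ^ (i + j) * biCoeff (a - i) (b - j) Φ) := by ring
        _ = _ := by rw [hi', hj', pow_add]; ring
    rw [h3]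
    linear_combination ((a.factorial : R) * b.factorial) * h2

/-! ### Lifting to polynomials in `α + t` and `α t` -/

/-- The polynomials with non-negative coefficients. -/
def nonnegPolynomials (σ : Type*) : Subsemiring (MvPolynomial σ ℚ) where
  carrier := {q | ∀ e, 0 ≤ MvPolynomial.coeff e q}
  mul_mem' := by
    classical
    intro p q hp hq e
    rw [MvPolynomial.coeff_mul]
    exact Finset.sum_nonneg fun x _ => mul_nonneg (hp _) (hq _)
  one_mem' := by
    classical
    intro e
    rw [MvPolynomial.coeff_one]
    split_ifs <;> norm_num
  add_mem' := by
    intro p q hp hq e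
    rw [MvPolynomial.coeff_add]
    exact add_nonneg (hp e) (hq e)
  zero_mem' := fun e => by simp

theorem X_mem_nonnegPolynomials {σ : Type*} (i : σ) :
    MvPolynomial.X i ∈ nonnegPolynomials σ := by
  classical
  intro e
  rw [MvPolynomial.coeff_X]
  split_ifs <;> norm_num

theorem algebraMap_mem_nonnegPolynomials {σ : Type*} {r : ℚ} (hr : 0 ≤ r) :
    algebraMap ℚ (MvPolynomial σ ℚ) r ∈ nonnegPolynomials σ := by
  classical
  intro e
  rw [MvPolynomial.algebraMap_eq, MvPolynomial.coeff_C]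
  split_ifs
  · exact hr
  · exact le_rfl

/-- The substitution of `α + t` and `α t` for the two variables. -/
abbrev elementarySubst : MvPolynomial (Fin 2) ℚ →ₐ[ℚ] MvPolynomial (Fin 2) ℚ :=
  MvPolynomial.aeval (R := ℚ) ![(MvPolynomial.X 0 + MvPolynomial.X 1 :
        MvPolynomial (Fin 2) ℚ), MvPolynomial.X 0 * MvPolynomial.X 1]

theorem derivative_map {R S : Type*} [CommSemiring R] [CommSemiring S] (f : R →+* S)
    (F : PowerSeries R) :
    PowerSeries.derivative S (PowerSeries.map f F) =
      PowerSeries.map f (PowerSeries.derivative R F) := by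
  ext n
  simp [PowerSeries.coeff_derivative]

theorem constantCoeff_map_eq_zero {R S : Type*} [CommSemiring R] [CommSemiring S] (f : R →+* S)
    {F : PowerSeries R} (hF : PowerSeries.constantCoeff F = 0) :
    PowerSeries.constantCoeff (PowerSeries.map f F) = 0 := by
  rw [← PowerSeries.coeff_zero_eq_constantCoeff_apply, PowerSeries.coeff_map,
    PowerSeries.coeff_zero_eq_constantCoeff_apply, hF, map_zero]

/-- The series `∑ h(P_{K_{k,l}}) x^k y^l / (k! l!)` over `k, l ≥ 1` comes from a series in
`α + t` and `α t` with non-negative coefficients, since every step of its construction (the two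
differential equations and the geometric series) preserves non-negativity. -/
theorem exists_nonneg_biCoeff_eq_faceEnumerator :
    ∃ H ∈ coeffSubsemiring (coeffSubsemiring (nonnegPolynomials (Fin 2))),
      (∀ m n, m = 0 ∨ n = 0 → biCoeff m n H = 0) ∧
      ∀ (m n : ℕ), faceEnumerator (MvPolynomial.X 0 - MvPolynomial.X 1 : MvPolynomial (Fin 2) ℚ)
        (MvPolynomial.X 1) (bipartiteBuildingSet m n) Finset.univ =
        (m.factorial : MvPolynomial (Fin 2) ℚ) * (n.factorial : MvPolynomial (Fin 2) ℚ) *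
          (MvPolynomial.X 1 * elementarySubst (biCoeff m n H) +
            biCoeff m n (inX (expSeries (MvPolynomial.X 1 : MvPolynomial (Fin 2) ℚ)) +
              inY (expSeries (MvPolynomial.X 1 : MvPolynomial (Fin 2) ℚ)) - 1)) := by
  set N := nonnegPolynomials (Fin 2)
  have hN : ∀ n : ℕ, algebraMap ℚ (MvPolynomial (Fin 2) ℚ) (1 / (n + 1)) ∈ N := fun n =>
    algebraMap_mem_nonnegPolynomials (by positivity)
  have hX0 : PowerSeries.C (MvPolynomial.X 0) ∈ coeffSubsemiring N :=
    C_mem_coeffSubsemiring (X_mem_nonnegPolynomials 0)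
  have hX1 : PowerSeries.C (MvPolynomial.X 1) ∈ coeffSubsemiring N :=
    C_mem_coeffSubsemiring (X_mem_nonnegPolynomials 1)
  obtain ⟨E, hEN, hE0, hE⟩ := exists_riccati hN (one_mem _) hX0 hX1
  obtain ⟨T, hTN, hT0, hT⟩ := exists_riccati hN (mul_mem hX1 hEN)
    (add_mem hX0 (mul_mem hX1 hEN)) (zero_mem (coeffSubsemiring N))
  rw [zero_mul, add_zero] at hT
  set K : PowerSeries (PowerSeries (MvPolynomial (Fin 2) ℚ)) :=
    inXY (MvPolynomial.X 1) * (inX E * inY E) with hK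
  set f : PowerSeries (PowerSeries (MvPolynomial (Fin 2) ℚ)) :=
    inX T * inY E + inX E * inY T + inXY (MvPolynomial.X 0) * (inX E * inY E) with hf
  have hEx := C_mem_coeffSubsemiring (N := coeffSubsemiring N) hEN
  have hEy := map_C_mem_coeffSubsemiring hEN
  have hTx := C_mem_coeffSubsemiring (N := coeffSubsemiring N) hTN
  have hTy := map_C_mem_coeffSubsemiring hTN
  have hKN : K ∈ coeffSubsemiring (coeffSubsemiring N) :=
    mul_mem (C_mem_coeffSubsemiring hX1) (mul_mem hEx hEy)
  have hfN : f ∈ coeffSubsemiring (coeffSubsemiring N) :=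
    add_mem (add_mem (mul_mem hTx hEy) (mul_mem hEx hTy))
      (mul_mem (C_mem_coeffSubsemiring hX0) (mul_mem hEx hEy))
  have hccY : ∀ F : PowerSeries (MvPolynomial (Fin 2) ℚ),
      PowerSeries.constantCoeff F = 0 → PowerSeries.constantCoeff (inY F) = 0 := by
    intro F hF
    exact constantCoeff_map_eq_zero _ hF
  have hK0 : PowerSeries.constantCoeff K = 0 := by
    rw [hK, map_mul, map_mul, hccY E hE0, mul_zero, mul_zero]
  obtain ⟨H, hH⟩ : ∃ H, H * (1 - K) = f := by
    refine ⟨f * PowerSeries.invOfUnit (1 - K) 1, ?_⟩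
    rw [mul_assoc, PowerSeries.invOfUnit_mul _ _ (by simp [hK0]), mul_one]
  have hHN : H ∈ coeffSubsemiring (coeffSubsemiring N) :=
    mem_coeffSubsemiring_of_eq_add_mul hfN hKN hK0 (by linear_combination hH)
  have hHleft : PowerSeries.constantCoeff H = 0 := by
    have h1 := congrArg PowerSeries.constantCoeff hH
    rw [map_mul, map_sub, hK0, map_one, sub_zero, mul_one, hf] at h1
    rw [h1]
    simp only [map_add, map_mul, hccY E hE0, hccY T hT0, mul_zero, add_zero]
  have hHright : PowerSeries.map PowerSeries.constantCoeff H = 0 := by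
    have hx : ∀ F : PowerSeries (MvPolynomial (Fin 2) ℚ), PowerSeries.constantCoeff F = 0 →
        PowerSeries.map PowerSeries.constantCoeff (inX F) = 0 := by
      intro F hF
      rw [PowerSeries.map_C, hF, map_zero]
    have h1 := congrArg (PowerSeries.map PowerSeries.constantCoeff) hH
    rw [map_mul, map_sub, map_one, hK, hf] at h1
    simpa only [map_add, map_mul, hx E hE0, hx T hT0, zero_mul, mul_zero, add_zero, sub_zero,
      mul_one] using h1
  have hH0 : ∀ m n, m = 0 ∨ n = 0 → biCoeff m n H = 0 := by
    rintro m n (rfl | rfl)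
    · have := congrArg (PowerSeries.coeff n) hHright
      rw [PowerSeries.coeff_map, map_zero] at this
      rw [biCoeff, PowerSeries.coeff_zero_eq_constantCoeff_apply, this]
    · rw [biCoeff, PowerSeries.coeff_zero_eq_constantCoeff_apply, hHleft, map_zero]
  refine ⟨H, hHN, hH0, fun m n => ?_⟩
  set φ : MvPolynomial (Fin 2) ℚ →+* MvPolynomial (Fin 2) ℚ := elementarySubst.toRingHom with hφ
  have hφ0 : φ (MvPolynomial.X 0) = MvPolynomial.X 0 + MvPolynomial.X 1 := by
    simp [hφ]
  have hφ1 : φ (MvPolynomial.X 1) = MvPolynomial.X 0 * MvPolynomial.X 1 := by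
    simp [hφ]
  have hmapX : ∀ F, PowerSeries.map (PowerSeries.map φ) (inX F) = inX (PowerSeries.map φ F) :=
    fun F => PowerSeries.map_C _ _
  have hmapY : ∀ F, PowerSeries.map (PowerSeries.map φ) (inY F) = inY (PowerSeries.map φ F) := by
    intro F
    ext n
    simp
  have hmapXY : ∀ r, PowerSeries.map (PowerSeries.map φ) (inXY r) = inXY (φ r) := by
    intro r
    simp
  have hbi : ∀ a b, biCoeff a b (PowerSeries.map (PowerSeries.map φ) H) = φ (biCoeff a b H) := by
    intro a b
    simp only [biCoeff, PowerSeries.coeff_map]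
  have hne : (MvPolynomial.X 0 - MvPolynomial.X 1 : MvPolynomial (Fin 2) ℚ) ≠ 0 :=
    sub_ne_zero.2 fun h => by simpa using MvPolynomial.X_injective h
  have hφE := congrArg (PowerSeries.map φ) hE
  have hφT := congrArg (PowerSeries.map φ) hT
  have hφH := congrArg (PowerSeries.map (PowerSeries.map φ)) hH
  rw [← derivative_map] at hφE hφT
  simp only [map_add, map_mul, map_one, PowerSeries.map_C, hφ0, hφ1] at hφE hφT
  simp only [hK, hf, map_add, map_sub, map_mul, map_one, hmapX, hmapY, hmapXY, hφ0, hφ1] at hφH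
  have key := faceEnumerator_eq_biCoeff hne (E := PowerSeries.map φ E)
    (T := PowerSeries.map φ T) (H := PowerSeries.map (PowerSeries.map φ) H)
    (constantCoeff_map_eq_zero φ hE0)
    (by simpa only [map_add, map_mul] using hφE)
    (constantCoeff_map_eq_zero φ hT0)
    (by simpa only [map_add, map_mul] using hφT)
    (fun a b hab => by rw [hbi, hH0 a b hab, map_zero])
    (by simpa only [map_add, map_mul] using hφH)
    (Finset.univ : Finset (Fin m ⊕ Fin n))
  have hcl : (Finset.univ : Finset (Fin m ⊕ Fin n)).toLeft.card = m := by
    have : (Finset.univ : Finset (Fin m ⊕ Fin n)).toLeft = Finset.univ := by ext; simp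
    rw [this, Finset.card_univ, Fintype.card_fin]
  have hcr : (Finset.univ : Finset (Fin m ⊕ Fin n)).toRight.card = n := by
    have : (Finset.univ : Finset (Fin m ⊕ Fin n)).toRight = Finset.univ := by ext; simp
    rw [this, Finset.card_univ, Fintype.card_fin]
  rw [hcl, hcr] at key
  rw [key, add_assoc, add_sub_assoc]
  congr 1
  have : φ (biCoeff m n H) = elementarySubst (biCoeff m n H) := rfl
  rw [← this, ← hbi, ← biCoeff_inXY_mul]
  simp only [biCoeff, map_add]

/-! ### From coefficients in `α + t` and `α t` to Gal series and `γ`-polynomials -/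

theorem rename_swap_elementarySubst (q : MvPolynomial (Fin 2) ℚ) :
    MvPolynomial.rename (R := ℚ) (Equiv.swap (0 : Fin 2) 1) (elementarySubst q) =
      elementarySubst q := by
  have h : (MvPolynomial.rename (R := ℚ) (Equiv.swap (0 : Fin 2) 1)).comp elementarySubst =
      elementarySubst := by
    apply MvPolynomial.algHom_ext
    intro i
    fin_cases i
    · simp [add_comm]
    · simp [mul_comm]
  exact DFunLike.congr_fun h q

theorem finTwo_finsupp_eq (e : Fin 2 →₀ ℕ) :
    e = Finsupp.single 0 (e 0) + Finsupp.single 1 (e 1) := by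
  ext i
  fin_cases i <;> simp

/-- The degree `N` part of a polynomial in `α + t` and `α t`: only the monomials
`(α + t) ^ (N - 2 i) (α t) ^ i` contribute to it. -/
theorem homogeneousComponent_elementarySubst (N : ℕ) (q : MvPolynomial (Fin 2) ℚ) :
    MvPolynomial.homogeneousComponent N (elementarySubst q) =
      ∑ i ∈ Finset.range (N / 2 + 1),
        MvPolynomial.C (MvPolynomial.coeff (Finsupp.single 0 (N - 2 * i) + Finsupp.single 1 i) q) *
          (MvPolynomial.X 0 * MvPolynomial.X 1) ^ i *
            (MvPolynomial.X 0 + MvPolynomial.X 1) ^ (N - 2 * i) := by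
  classical
  induction q using MvPolynomial.induction_on' with
  | add p q hp hq =>
    rw [map_add, map_add, hp, hq, ← Finset.sum_add_distrib]
    refine Finset.sum_congr rfl fun i _ => ?_
    rw [MvPolynomial.coeff_add, map_add]
    ring
  | monomial e r =>
    have hval : elementarySubst (MvPolynomial.monomial e r) = MvPolynomial.C r *
        ((MvPolynomial.X 0 + MvPolynomial.X 1) ^ e 0 *
          (MvPolynomial.X 0 * MvPolynomial.X 1) ^ e 1) := by
      rw [MvPolynomial.aeval_monomial, Finsupp.prod_fintype _ _ (by simp), Fin.prod_univ_two]
      simp [MvPolynomial.algebraMap_eq]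
    have hhom : (elementarySubst (MvPolynomial.monomial e r)).IsHomogeneous (e 0 + 2 * e 1) := by
      rw [hval]
      have h1 := ((MvPolynomial.isHomogeneous_X ℚ (0 : Fin 2)).add
        (MvPolynomial.isHomogeneous_X ℚ 1)).pow (e 0)
      have h2 := ((MvPolynomial.isHomogeneous_X ℚ (0 : Fin 2)).mul
        (MvPolynomial.isHomogeneous_X ℚ 1)).pow (e 1)
      convert (MvPolynomial.isHomogeneous_C (Fin 2) r).mul (h1.mul h2) using 1
      omega
    rw [MvPolynomial.homogeneousComponent_of_mem
      ((MvPolynomial.mem_homogeneousSubmodule _ _).2 hhom)]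
    simp only [MvPolynomial.coeff_monomial]
    have hiff : ∀ i, e = Finsupp.single 0 (N - 2 * i) + Finsupp.single 1 i ↔
        e 0 = N - 2 * i ∧ e 1 = i := by
      intro i
      constructor
      · intro h
        rw [h]
        simp
      · rintro ⟨h0, h1⟩
        conv_lhs => rw [finTwo_finsupp_eq e, h0, h1]
    simp only [hiff]
    split_ifs with hN
    · rw [Finset.sum_eq_single (e 1)]
      · rw [if_pos ⟨by omega, rfl⟩, hval]
        have : N - 2 * e 1 = e 0 := by omega
        rw [this]
        ring
      · intro i _ hi
        rw [if_neg fun h => hi h.2.symm]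
        simp
      · intro h
        exact absurd (Finset.mem_range.2 (by omega)) h
    · symm
      refine Finset.sum_eq_zero fun i hi => ?_
      rw [Finset.mem_range] at hi
      rw [if_neg (by rintro ⟨h0, h1⟩; omega)]
      simp

/-- If the `h`-polynomial is a polynomial in `α + t` and `α t` with non-negative coefficients,
then, being homogeneous, it has a `γ`-polynomial with non-negative coefficients. -/
theorem exists_isGammaPolynomial_of_hPolynomial_eq {E : Type*} [NormedAddCommGroup E]
    [NormedSpace ℝ E] {P : Set E} {q : MvPolynomial (Fin 2) ℚ}
    (hq : q ∈ nonnegPolynomials (Fin 2)) (h : hPolynomial P = elementarySubst q) :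
    ∃ γ : Polynomial ℚ, IsGammaPolynomial P γ ∧ ∀ i : ℕ, 0 ≤ γ.coeff i := by
  set N := polytopeDim P with hN
  set c : ℕ → ℚ := fun i =>
    MvPolynomial.coeff (Finsupp.single 0 (N - 2 * i) + Finsupp.single 1 i) q with hc
  have hcoeff : ∀ i, (∑ j ∈ Finset.range (N / 2 + 1), Polynomial.monomial j (c j)).coeff i =
      if i ∈ Finset.range (N / 2 + 1) then c i else 0 := by
    intro i
    rw [Polynomial.finsetSum_coeff]
    simp only [Polynomial.coeff_monomial]
    rw [Finset.sum_ite_eq']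
  refine ⟨∑ j ∈ Finset.range (N / 2 + 1), Polynomial.monomial j (c j), ⟨?_, ?_⟩, fun i => ?_⟩
  · have hdeg : (∑ j ∈ Finset.range (N / 2 + 1), Polynomial.monomial j (c j)).natDegree ≤
        N / 2 :=
      Polynomial.natDegree_sum_le_of_forall_le _ _ fun j hj =>
        (Polynomial.natDegree_monomial_le _).trans (Nat.lt_succ_iff.1 (Finset.mem_range.1 hj))
    omega
  · have hself : MvPolynomial.homogeneousComponent N (hPolynomial P) = hPolynomial P := by
      rw [MvPolynomial.homogeneousComponent_of_mem
        ((MvPolynomial.mem_homogeneousSubmodule _ _).2 (isHomogeneous_hPolynomial P)), if_pos hN]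
    rw [← hself, h, homogeneousComponent_elementarySubst, ← hN]
    refine Finset.sum_congr rfl fun i hi => ?_
    rw [hcoeff, if_pos hi]
  · rw [hcoeff]
    split_ifs
    · exact hq _
    · exact le_rfl

theorem X_mul_hPolynomial_bipartiteNestohedron {m n : ℕ}
    (h : (completeBipartiteGraph (Fin m) (Fin n)).Connected) :
    MvPolynomial.X 1 * hPolynomial (bipartiteNestohedron m n) =
      faceEnumerator (MvPolynomial.X 0 - MvPolynomial.X 1 : MvPolynomial (Fin 2) ℚ)
        (MvPolynomial.X 1) (bipartiteBuildingSet m n) Finset.univ :=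
  have := h.nonempty
  X_mul_hPolynomial_nestohedron (fun _ => nonempty_of_mem_graphicalBuildingSet)
    (univ_mem_graphicalBuildingSet.2 h)

theorem polytopeDim_bipartiteNestohedron {m n : ℕ}
    (h : (completeBipartiteGraph (Fin m) (Fin n)).Connected) :
    polytopeDim (bipartiteNestohedron m n) + 1 = m + n := by
  have := h.nonempty
  have h1 : polytopeDim (bipartiteNestohedron m n) = Fintype.card (Fin m ⊕ Fin n) - 1 :=
    polytopeDim_nestohedron (fun _ => nonempty_of_mem_graphicalBuildingSet)
      (univ_mem_graphicalBuildingSet.2 h)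
  have h2 : 0 < Fintype.card (Fin m ⊕ Fin n) := Fintype.card_pos
  rw [Fintype.card_sum, Fintype.card_fin, Fintype.card_fin] at h1 h2
  omega

open Classical in
/-- The terms `x` and `y`, for the one-vertex graphs `K_{1,0}` and `K_{0,1}`, complete the series
over `k, l ≥ 1`. -/
theorem exists_nonneg_elementarySubst_biCoeff_eq :
    ∃ G ∈ coeffSubsemiring (coeffSubsemiring (nonnegPolynomials (Fin 2))),
      ∀ m n, elementarySubst (biCoeff m n G) =
        if (completeBipartiteGraph (Fin m) (Fin n)).Connected then
          MvPolynomial.C (1 / (m.factorial * n.factorial : ℚ)) *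
            hPolynomial (bipartiteNestohedron m n)
        else 0 := by
  obtain ⟨H, hHN, hH0, hH⟩ := exists_nonneg_biCoeff_eq_faceEnumerator
  have hX := X_mem_coeffSubsemiring (N := nonnegPolynomials (Fin 2))
  refine ⟨H + (inX PowerSeries.X + inY PowerSeries.X),
    add_mem hHN (add_mem (C_mem_coeffSubsemiring hX) (map_C_mem_coeffSubsemiring hX)), ?_⟩
  intro m n
  have hG : biCoeff m n (H + (inX PowerSeries.X + inY PowerSeries.X)) = biCoeff m n H +
      (biCoeff m n (inX PowerSeries.X) + biCoeff m n (inY PowerSeries.X)) := by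
    simp only [biCoeff, map_add]
  have hR : biCoeff m n (inX (expSeries (MvPolynomial.X 1 : MvPolynomial (Fin 2) ℚ)) +
      inY (expSeries (MvPolynomial.X 1)) - 1) =
      biCoeff m n (inX (expSeries (MvPolynomial.X 1 : MvPolynomial (Fin 2) ℚ))) +
      biCoeff m n (inY (expSeries (MvPolynomial.X 1))) - biCoeff m n (inX 1) := by
    simp only [biCoeff, map_add, map_sub, map_one]
  have hHmn := hH m n
  have hX1 : (MvPolynomial.X 1 : MvPolynomial (Fin 2) ℚ) ≠ 0 := MvPolynomial.X_ne_zero 1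
  rw [hR, biCoeff_inX, biCoeff_inY, biCoeff_inX] at hHmn
  rw [hG, biCoeff_inX, biCoeff_inY]
  have hc1 : PowerSeries.coeff 1 (expSeries (MvPolynomial.X 1 : MvPolynomial (Fin 2) ℚ)) =
      MvPolynomial.X 1 := by simp [expSeries]
  have hc0 : PowerSeries.coeff 0 (expSeries (MvPolynomial.X 1 : MvPolynomial (Fin 2) ℚ)) =
      1 := by simp [expSeries]
  by_cases hconn : (completeBipartiteGraph (Fin m) (Fin n)).Connected
  · rw [if_pos hconn]
    have hh := (X_mul_hPolynomial_bipartiteNestohedron hconn).trans hHmn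
    rcases completeBipartiteGraph_connected_iff.1 hconn with ⟨hm, hn⟩ | hmn
    · simp only [if_neg hm.ne', if_neg hn.ne', add_zero, sub_zero] at hh ⊢
      have h1 : hPolynomial (bipartiteNestohedron m n) =
          (m.factorial : MvPolynomial (Fin 2) ℚ) * (n.factorial : MvPolynomial (Fin 2) ℚ) *
            elementarySubst (biCoeff m n H) := by
        apply mul_left_cancel₀ hX1
        rw [hh]
        ring
      have h2 : (MvPolynomial.C (1 / (m.factorial * n.factorial : ℚ)) :
          MvPolynomial (Fin 2) ℚ) *
          ((m.factorial : MvPolynomial (Fin 2) ℚ) * (n.factorial : MvPolynomial (Fin 2) ℚ)) =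
          1 := by
        rw [← map_natCast (MvPolynomial.C (σ := Fin 2) (R := ℚ)) m.factorial,
          ← map_natCast (MvPolynomial.C (σ := Fin 2) (R := ℚ)) n.factorial, ← map_mul, ← map_mul,
          one_div_mul_cancel (by positivity), map_one]
      rw [h1, ← mul_assoc, h2, one_mul]
    · have hcases : (m = 1 ∧ n = 0) ∨ (m = 0 ∧ n = 1) := by omega
      rcases hcases with ⟨rfl, rfl⟩ | ⟨rfl, rfl⟩
      · rw [hH0 1 0 (Or.inr rfl), hc1] at hh
        rw [hH0 1 0 (Or.inr rfl)]
        have h1 : hPolynomial (bipartiteNestohedron 1 0) = 1 := by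
          apply mul_left_cancel₀ hX1
          rw [hh]
          simp [PowerSeries.coeff_one]
        rw [h1]
        simp
      · rw [hH0 0 1 (Or.inl rfl), hc1] at hh
        rw [hH0 0 1 (Or.inl rfl)]
        have h1 : hPolynomial (bipartiteNestohedron 0 1) = 1 := by
          apply mul_left_cancel₀ hX1
          rw [hh]
          simp
        rw [h1]
        simp
  · rw [if_neg hconn]
    rw [completeBipartiteGraph_connected_iff] at hconn
    push Not at hconn
    rw [hH0 m n (by have := hconn.1; omega)]
    have h1 : m ≠ 1 ∨ n ≠ 0 := by have := hconn.2; omega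
    have h2 : n ≠ 1 ∨ m ≠ 0 := by have := hconn.2; omega
    have h3 : (if n = 0 then PowerSeries.coeff m (PowerSeries.X :
        PowerSeries (MvPolynomial (Fin 2) ℚ)) else 0) = 0 := by
      rw [PowerSeries.coeff_X]
      split_ifs <;> first | rfl | (exfalso; omega)
    have h4 : (if m = 0 then PowerSeries.coeff n (PowerSeries.X :
        PowerSeries (MvPolynomial (Fin 2) ℚ)) else 0) = 0 := by
      rw [PowerSeries.coeff_X]
      split_ifs <;> first | rfl | (exfalso; omega)
    rw [h3, h4, add_zero, add_zero, map_zero]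

end

theorem mainTheorem1 :
    IsGalSeries bipartiteHSeries ∧
      ∀ m n : ℕ, (completeBipartiteGraph (Fin m) (Fin n)).Connected →
        ∃ γ : Polynomial ℚ, IsGammaPolynomial (bipartiteNestohedron m n) γ ∧
          ∀ i : ℕ, 0 ≤ γ.coeff i := by
  obtain ⟨G, hGN, hG⟩ := exists_nonneg_elementarySubst_biCoeff_eq
  set G' : MvPowerSeries (Fin 2) (MvPolynomial (Fin 2) ℚ) := fun d => biCoeff (d 0) (d 1) G
    with hG'
  have hmap : bipartiteHSeries = MvPowerSeries.map elementarySubst.toRingHom G' := by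
    ext1 d
    rw [MvPowerSeries.coeff_map]
    exact (hG (d 0) (d 1)).symm
  refine ⟨⟨?_, ⟨2, fun d e he => ?_⟩, ⟨G', hmap, fun d e => hGN (d 1) (d 0) e⟩⟩, fun m n h => ?_⟩
  · rw [hmap]
    ext1 d
    rw [MvPowerSeries.coeff_map, MvPowerSeries.coeff_map]
    exact rename_swap_elementarySubst _
  · have hd : MvPowerSeries.coeff d bipartiteHSeries = bipartiteHSeries d := rfl
    rw [hd, bipartiteHSeries] at he
    split_ifs at he with hconn
    · rw [MvPolynomial.coeff_C_mul] at he
      have hdeg : e.degree = polytopeDim (bipartiteNestohedron (d 0) (d 1)) := by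
        by_contra hne
        exact he (by rw [(isHomogeneous_hPolynomial _).coeff_eq_zero hne, mul_zero])
      have hdim := polytopeDim_bipartiteNestohedron hconn
      rw [Finsupp.degree_eq_sum d, Fin.sum_univ_two, hdeg]
      omega
    · simp at he
  · have hmn := hG m n
    rw [if_pos h] at hmn
    refine exists_isGammaPolynomial_of_hPolynomial_eq
      (q := algebraMap ℚ _ (m.factorial * n.factorial : ℚ) * biCoeff m n G)
      (mul_mem (algebraMap_mem_nonnegPolynomials (by positivity)) (hGN n m)) ?_
    rw [map_mul, AlgHom.commutes, hmn, MvPolynomial.algebraMap_eq, ← mul_assoc, ← map_mul,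
      mul_one_div_cancel (by positivity), map_one, one_mul]
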